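/- Let $X$ be a complex Banach space and let $-A$ be the generator of a bounded $C_0$-semigroup $(e^{-tA})_{t\ge 0}$ on $X$. Suppose that the range of $A$ is dense in $X$ and that $\sigma(A)\cap i\mathbb R$ accumulates at infinity, i.e. is unbounded. For $n\in\mathbb N=\{1,2,\dots\}$ and $t>0$ put $$\Delta_{n,t}(A):=\Bigl(1+\frac tn A\Bigr)^{-n}-e^{-tA}.$$ A Stieltjes function is a function of the form $f(z)=a+\int_{[0,\infty)}\frac{\mu(d\tau)}{z+\tau}$, $z>0$, with $a\ge 0$ and $\mu$ a positive Radon measure on $[0,\infty)$ such that $\int_{[0,\infty)}\frac{\mu(d\tau)}{1+\tau}<\infty$; it is identified with its analytic extension to $\mathbb C\setminus(-\infty,0]$. Let $\tilde{\mathcal S}_2$ be the set of all products $f_1f_2$ of two Stieltjes functions. For $\mu$ a complex Borel measure on $[0,\infty)$ with Laplace transform $\mathcal L\mu$, put $(\mathcal L\mu)(A)x:=\int_{[0,\infty)}e^{-sA}x\,\mu(ds)$, $x\in X$. A holomorphic function $f$ on $\{\operatorname{Re}z>0\}$ belongs to the extended Hille–Phillips calculus of $A$ if there are complex Borel measures $\mu,\nu$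 on $[0,\infty)$ such that, with $e=\mathcal L\mu$, the operator $e(A)$ is injective and $ef=\mathcal L\nu$ on $\{\operatorname{Re}z>0\}$; then $f(A):=e(A)^{-1}(ef)(A)$ with its natural domain, which does not depend on the choice of $e$. Let $f\in\tilde{\mathcal S}_2$, $f\ne 0$. Then $f$ belongs to the extended Hille–Phillips calculus of $A$, the operator $f(A)\Delta_{n,t}(A)$ (with its natural domain) is everywhere defined and bounded on $X$ for all $n\in\mathbb N$ and $t>0$, and $$\limsup_{\sqrt n/t\to\infty}\frac{\|f(A)\Delta_{n,t}(A)\|}{f(\sqrt n/t)}>0 .$$ -/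

import Mathlib

open MeasureTheory Filter Topology
open scoped NNReal ENNReal

noncomputable section

/-! ### Complex Borel measures on the half-line and their Laplace transforms -/

/-- A complex measure has finite total variation. -/
instance complexMeasureFiniteVariation (μ : ComplexMeasure ℝ≥0) :
    IsFiniteMeasure μ.variation := by
  have h : μ.variation ≤ (ComplexMeasure.re μ).totalVariation +
      (ComplexMeasure.im μ).totalVariation := by
    refine VectorMeasure.variation_le_of_forall_enorm_le fun s _ ↦ ?_
    have h1 : ‖μ s‖ₑ ≤ ‖(μ s).re‖ₑ + ‖(μ s).im‖ₑ := by
      simp only [← ofReal_norm]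
      rw [← ENNReal.ofReal_add (norm_nonneg _) (norm_nonneg _)]
      exact ENNReal.ofReal_le_ofReal (Complex.norm_le_abs_re_add_abs_im _)
    refine h1.trans ?_
    rw [Measure.add_apply]
    exact add_le_add ((ComplexMeasure.re μ).enorm_le_totalVariation s)
      ((ComplexMeasure.im μ).enorm_le_totalVariation s)
  have : IsFiniteMeasure ((ComplexMeasure.re μ).totalVariation +
      (ComplexMeasure.im μ).totalVariation) := by
    unfold SignedMeasure.totalVariation
    infer_instance
  exact isFiniteMeasure_of_le _ h

/-- The integral `∫ g(s) μ(ds)` of a vector-valued function against a complex measure. -/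
def complexIntegral {E : Type*} [NormedAddCommGroup E] [NormedSpace ℂ E]
    (μ : ComplexMeasure ℝ≥0) (g : ℝ≥0 → E) : E :=
  μ.integral g (ContinuousLinearMap.lsmul ℝ ℂ : ℂ →L[ℝ] E →L[ℝ] E).flip

/-- The Laplace transform `(ℒμ)(z) = ∫ e^{-sz} μ(ds)`. -/
def laplaceTransform (μ : ComplexMeasure ℝ≥0) (z : ℂ) : ℂ :=
  complexIntegral μ fun s : ℝ≥0 ↦ Complex.exp (-((s : ℝ) : ℂ) * z)

/-! ### Unbounded operators -/

section Operators

variable {X : Type*} [NormedAddCommGroup X] [NormedSpace ℂ X]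

/-- `R` is an everywhere defined bounded two-sided inverse of the operator `B`. -/
def IsBoundedInverse (B : X →ₗ.[ℂ] X) (R : X →L[ℂ] X) : Prop :=
  (∀ y : X, ∃ h : R y ∈ B.domain, B ⟨R y, h⟩ = y) ∧ ∀ x : B.domain, R (B x) = x

open Classical in
/-- The bounded inverse `B⁻¹` (with value `0` if `B` has no bounded inverse). -/
def boundedInverse (B : X →ₗ.[ℂ] X) : X →L[ℂ] X :=
  if h : ∃ R : X →L[ℂ] X, IsBoundedInverse B R then h.choose else 0

/-- The spectrum of an operator `A`: all `z` such that `z - A`, with domain `dom A`, has no bounded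
everywhere defined inverse. -/
def operatorSpectrum (A : X →ₗ.[ℂ] X) : Set ℂ :=
  {z | ¬ ∃ R : X →L[ℂ] X, IsBoundedInverse ((z • LinearMap.id : X →ₗ[ℂ] X) +ᵥ (-A)) R}

/-- The product `B D` of an operator `B` and a bounded operator `D`, with its natural domain
`{x | D x ∈ dom B}`. -/
def compBounded (B : X →ₗ.[ℂ] X) (D : X →L[ℂ] X) : X →ₗ.[ℂ] X where
  domain := B.domain.comap (D : X →ₗ[ℂ] X)
  toFun := B.toFun.comp ((D : X →ₗ[ℂ] X).restrict fun _ hx ↦ hx)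

end Operators

/-! ### Bounded `C₀`-semigroups and the extended Hille-Phillips calculus -/

/-- A bounded `C₀`-semigroup of bounded linear operators on `X`. -/
structure BoundedC0Semigroup (X : Type*) [NormedAddCommGroup X] [NormedSpace ℂ X] where
  toFun : ℝ≥0 → X →L[ℂ] X
  map_zero' : toFun 0 = ContinuousLinearMap.id ℂ X
  map_add' : ∀ s t, toFun (s + t) = (toFun s).comp (toFun t)
  continuous' : ∀ x, Continuous fun t ↦ toFun t x
  bounded' : ∃ M : ℝ, ∀ t, ‖toFun t‖ ≤ M

namespace BoundedC0Semigroup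

variable {X : Type*} [NormedAddCommGroup X] [NormedSpace ℂ X]

/-- `B` is the infinitesimal generator of `T`: `x ∈ dom B` and `B x = y` if and only if
`(T(h)x - x) / h → y` as `h → 0+`. -/
def IsGenerator (T : BoundedC0Semigroup X) (B : X →ₗ.[ℂ] X) : Prop :=
  ∀ x y : X, (x, y) ∈ B.graph ↔
    Tendsto (fun h : ℝ≥0 ↦ (h : ℝ)⁻¹ • (T.toFun h x - x)) (𝓝[>] 0) (𝓝 y)

theorem integrable_orbit (T : BoundedC0Semigroup X) (μ : ComplexMeasure ℝ≥0) (x : X) :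
    μ.Integrable fun s ↦ T.toFun s x := by
  obtain ⟨M, hM⟩ := T.bounded'
  exact Integrable.of_bound (T.continuous' x).aestronglyMeasurable (M * ‖x‖)
    (Eventually.of_forall fun s ↦ (T.toFun s).le_of_opNorm_le (hM s) x)

/-- The Hille-Phillips calculus: for `g = ℒμ` and `T(s) = e^{-sA}`, this is the bounded operator
`g(A) x = ∫ e^{-sA} x μ(ds)`. -/
def hillePhillips (T : BoundedC0Semigroup X) (μ : ComplexMeasure ℝ≥0) : X →L[ℂ] X :=
  LinearMap.mkContinuousOfExistsBound
    { toFun := fun x ↦ complexIntegral μ fun s ↦ T.toFun s x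
      map_add' := fun x y ↦ by
        simp only [complexIntegral, map_add]
        exact VectorMeasure.integral_fun_add (T.integrable_orbit μ x) (T.integrable_orbit μ y)
      map_smul' := fun c x ↦ by
        simp only [complexIntegral, map_smul, RingHom.id_apply]
        refine setToFun_smul _ (fun d s y ↦ ?_) c _
        simp only [VectorMeasure.transpose]
        exact smul_comm (μ s) d y }
    (by
      obtain ⟨M, hM⟩ := T.bounded'
      let L : ℂ →L[ℝ] X →L[ℝ] X := ContinuousLinearMap.lsmul ℝ ℂ
      refine ⟨M * ‖L.flip‖ * μ.variation.real Set.univ, fun x ↦ ?_⟩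
      refine (VectorMeasure.norm_integral_le_of_norm_le_const (C := M * ‖x‖) (B := L.flip)
        (Eventually.of_forall fun s ↦ (T.toFun s).le_of_opNorm_le (hM s) x)).trans
        (le_of_eq (by ring)))

/-- `e = ℒμ` is a regularizer for `f`, with `e f = ℒν` on the right half-plane: the operator `e(A)`
is injective. -/
def IsRegularizer (T : BoundedC0Semigroup X) (f : ℂ → ℂ) (μ ν : ComplexMeasure ℝ≥0) : Prop :=
  Function.Injective (T.hillePhillips μ) ∧
    ∀ z : ℂ, 0 < z.re → laplaceTransform μ z * f z = laplaceTransform ν z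

/-- `f`, holomorphic on the right half-plane, belongs to the extended Hille-Phillips calculus. -/
def Regularizable (T : BoundedC0Semigroup X) (f : ℂ → ℂ) : Prop :=
  DifferentiableOn ℂ f {z | 0 < z.re} ∧ ∃ μν : ComplexMeasure ℝ≥0 × ComplexMeasure ℝ≥0,
    T.IsRegularizer f μν.1 μν.2

open Classical in
/-- The extended Hille-Phillips calculus `f(A) = e(A)⁻¹ (e f)(A)`, for a regularizer `e` of `f`:
`x ∈ dom f(A)` and `f(A) x = y` if and only if `e(A) y = (e f)(A) x`. The operator does not depend
on the choice of the regularizer. (It is `0` if `f` is not regularizable.) -/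
def extendedCalculus (T : BoundedC0Semigroup X) (f : ℂ → ℂ) : X →ₗ.[ℂ] X :=
  if h : T.Regularizable f then
    (LinearMap.ker
      ((T.hillePhillips h.2.choose.2 : X →ₗ[ℂ] X).comp (LinearMap.fst ℂ X X) -
        (T.hillePhillips h.2.choose.1 : X →ₗ[ℂ] X).comp (LinearMap.snd ℂ X X))).toLinearPMap
  else 0

/-- `Δ_{n,t}(A) = (1 + (t/n) A)^{-n} - e^{-tA}`, the error of the Euler approximation, where
`-A` is the generator of `T`. -/
def eulerError (T : BoundedC0Semigroup X) (A : X →ₗ.[ℂ] X) (n : ℕ) (t : ℝ≥0) : X →L[ℂ] X :=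
  boundedInverse ((LinearMap.id : X →ₗ[ℂ] X) +ᵥ ((((t : ℝ) / n : ℝ) : ℂ) • A)) ^ n - T.toFun t

end BoundedC0Semigroup

/-! ### Stieltjes functions -/

/-- Stieltjes functions `f(z) = a + ∫ μ(dτ) / (z + τ)`, with `a ≥ 0` and `μ` a positive measure on
`[0, ∞)` with `∫ μ(dτ) / (1 + τ) < ∞`, in their analytic extension from `(0, ∞)` to
`ℂ \ (-∞, 0]`. (The integrability condition makes `μ` finite on bounded sets.) -/
def IsStieltjes (f : ℂ → ℂ) : Prop :=
  ∃ (a : ℝ) (μ : Measure ℝ≥0), 0 ≤ a ∧ Integrable (fun τ : ℝ≥0 ↦ (1 + (τ : ℝ))⁻¹) μ ∧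
    ∀ z ∈ Complex.slitPlane, f z = a + ∫ τ : ℝ≥0, (z + ((τ : ℝ) : ℂ))⁻¹ ∂μ

/-- Products of two Stieltjes functions. -/
def IsStieltjesProduct (f : ℂ → ℂ) : Prop :=
  ∃ f₁ f₂ : ℂ → ℂ, IsStieltjes f₁ ∧ IsStieltjes f₂ ∧
    ∀ z ∈ Complex.slitPlane, f z = f₁ z * f₂ z

/-- The filter on pairs `(n, t)` with `n ≥ 1` and `t > 0` that expresses `√n / t → ∞`. -/
def sqrtDivAtTop : Filter (ℕ × ℝ≥0) :=
  comap (fun p ↦ √(p.1 : ℝ) / (p.2 : ℝ)) atTop ⊓ 𝓟 {p | 1 ≤ p.1 ∧ 0 < p.2}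

end

noncomputable section

/-! ### Complex measures as combinations of finite positive measures -/

section FourMeasures

variable {E : Type*} [NormedAddCommGroup E] [NormedSpace ℂ E] [CompleteSpace E]

/-! Boundedness rests on a cancellation at the origin. For a Stieltjes function `g`, the function `z
g(z) / (1 + z)` is a Laplace transform, so `z² f(z) / (1 + z)²` is one for a product `f`
(`exists_mem_of_isStieltjesProduct`). The operator of `(z / (1 + z))²` is injective because dense
range and boundedness of the semigroup force `ker A = 0`; this regularizes `f`. The Euler error
vanishes to second order at `0`, so `(1 + z)² Δ(z) / z²` is a Laplace transform too
(`exists_mem_eulerError`), and `f Δ` is the product of the two.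

The lower bound needs only `n = 1`. If `is ∈ σ(A)`, then `is` is an approximate eigenvalue and
`‖F(A)‖ ≥ |F(is)|` throughout the calculus (`norm_apply_le_opNorm`). With `t = 1/|s|` one has `√n /
t = |s|` and `t · is = ±i`, where `|Δ| ≥ 1/4`; moreover `|f(is)| ≥ f(|s|) / 2`. The quotient is
therefore at least `1/8` for these `t`, and `|s|` is unbounded.

Functions and operators are carried together as pairs in one algebra, `calculusAlgebra`. By
uniqueness of Laplace transforms the function determines the operator (`snd_eq_of_fst_eq`), so
operator identities are checked on scalars. -/

theorem complexIntegral_eq_of_apply_eq (μ : ComplexMeasure ℝ≥0) (m₁ m₂ m₃ m₄ : Measure ℝ≥0)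
    [IsFiniteMeasure m₁] [IsFiniteMeasure m₂] [IsFiniteMeasure m₃] [IsFiniteMeasure m₄]
    (hμ : ∀ s, MeasurableSet s →
      μ s = ((m₁.real s - m₂.real s : ℝ) : ℂ) + Complex.I * ((m₃.real s - m₄.real s : ℝ) : ℂ))
    {g : ℝ≥0 → E} (hg : StronglyMeasurable g) {C : ℝ} (hC : ∀ s, ‖g s‖ ≤ C) :
    complexIntegral μ g =
      (∫ s, g s ∂m₁ - ∫ s, g s ∂m₂) + Complex.I • (∫ s, g s ∂m₃ - ∫ s, g s ∂m₄) := by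
  have hint (m : Measure ℝ≥0) [IsFiniteMeasure m] (φ : SimpleFunc ℝ≥0 E) : Integrable φ m :=
    φ.integrable_of_isFiniteMeasure
  -- Both sides are additive and agree on indicators; dominated convergence along simple functions
  -- bounded by `C` gives the general case.
  have simple : ∀ φ : SimpleFunc ℝ≥0 E, complexIntegral μ φ =
      (∫ s, φ s ∂m₁ - ∫ s, φ s ∂m₂) + Complex.I • (∫ s, φ s ∂m₃ - ∫ s, φ s ∂m₄) := by
    intro φ
    induction φ using SimpleFunc.induction with
    | const c hs =>
      rename_i s
      simp only [SimpleFunc.coe_piecewise, SimpleFunc.coe_const, complexIntegral,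
        Function.const_zero, Set.piecewise_eq_indicator]
      have h1 : Set.indicator s (Function.const ℝ≥0 c) = s.indicator fun _ ↦ c := rfl
      rw [h1, VectorMeasure.integral_indicator_const _ hs]
      simp only [integral_indicator_const _ hs, ContinuousLinearMap.flip_apply,
        ContinuousLinearMap.lsmul_apply, hμ s hs]
      simp only [← Complex.coe_smul]
      push_cast
      module
    | add _ h₁ h₂ =>
      rename_i f g _
      have e : complexIntegral μ (⇑f + ⇑g) = complexIntegral μ f + complexIntegral μ g :=
        VectorMeasure.integral_add (hint _ f) (hint _ g)
      simp only [SimpleFunc.coe_add, Pi.add_apply]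
      rw [e, h₁, h₂, integral_add (hint m₁ f) (hint m₁ g), integral_add (hint m₂ f) (hint m₂ g),
        integral_add (hint m₃ f) (hint m₃ g), integral_add (hint m₄ f) (hint m₄ g)]
      module
  have hC0 : 0 ≤ C := (norm_nonneg _).trans (hC 0)
  have lim (m : Measure ℝ≥0) [IsFiniteMeasure m] :
      Tendsto (fun n ↦ ∫ s, hg.approxBounded C n s ∂m) atTop (𝓝 (∫ s, g s ∂m)) := by
    refine tendsto_integral_of_dominated_convergence (fun _ ↦ C)
      (fun n ↦ (hint m _).aestronglyMeasurable) (integrable_const _)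
      (fun n ↦ Eventually.of_forall fun s ↦ hg.norm_approxBounded_le hC0 n s)
      (Eventually.of_forall fun s ↦ hg.tendsto_approxBounded_of_norm_le (hC s))
  have limc : Tendsto (fun n ↦ complexIntegral μ (hg.approxBounded C n)) atTop
      (𝓝 (complexIntegral μ g)) := by
    refine VectorMeasure.tendsto_integral_of_dominated_convergence (fun _ ↦ C)
      (fun n ↦ (hint _ _).aestronglyMeasurable) (integrable_const _)
      (fun n ↦ Eventually.of_forall fun s ↦ hg.norm_approxBounded_le hC0 n s)
      (Eventually.of_forall fun s ↦ hg.tendsto_approxBounded_of_norm_le (hC s))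
  refine tendsto_nhds_unique limc ?_
  simp only [simple]
  exact ((lim m₁).sub (lim m₂)).add (((lim m₃).sub (lim m₄)).const_smul Complex.I)

theorem exists_measures_of_complexMeasure (μ : ComplexMeasure ℝ≥0) :
    ∃ m₁ m₂ m₃ m₄ : Measure ℝ≥0, IsFiniteMeasure m₁ ∧ IsFiniteMeasure m₂ ∧ IsFiniteMeasure m₃ ∧
      IsFiniteMeasure m₄ ∧ ∀ s, MeasurableSet s → μ s =
        ((m₁.real s - m₂.real s : ℝ) : ℂ) + Complex.I * ((m₃.real s - m₄.real s : ℝ) : ℂ) := by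
  have key (ν : SignedMeasure ℝ≥0) (s : Set ℝ≥0) (hs : MeasurableSet s) :
      ν s = ν.toJordanDecomposition.posPart.real s - ν.toJordanDecomposition.negPart.real s := by
    conv_lhs => rw [← ν.toSignedMeasure_toJordanDecomposition]
    exact Measure.toSignedMeasure_sub_apply hs
  refine ⟨(ComplexMeasure.re μ).toJordanDecomposition.posPart,
    (ComplexMeasure.re μ).toJordanDecomposition.negPart,
    (ComplexMeasure.im μ).toJordanDecomposition.posPart,
    (ComplexMeasure.im μ).toJordanDecomposition.negPart,
    inferInstance, inferInstance, inferInstance, inferInstance, fun s hs ↦ ?_⟩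
  rw [← key _ s hs, ← key _ s hs, mul_comm]
  exact (Complex.re_add_im (μ s)).symm

theorem exists_complexMeasure_of_measures (m₁ m₂ m₃ m₄ : Measure ℝ≥0)
    [IsFiniteMeasure m₁] [IsFiniteMeasure m₂] [IsFiniteMeasure m₃] [IsFiniteMeasure m₄] :
    ∃ μ : ComplexMeasure ℝ≥0, ∀ s, MeasurableSet s → μ s =
        ((m₁.real s - m₂.real s : ℝ) : ℂ) + Complex.I * ((m₃.real s - m₄.real s : ℝ) : ℂ) := by
  refine ⟨(m₁.toSignedMeasure - m₂.toSignedMeasure).toComplexMeasure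
    (m₃.toSignedMeasure - m₄.toSignedMeasure), fun s hs ↦ ?_⟩
  rw [SignedMeasure.toComplexMeasure_apply, Measure.toSignedMeasure_sub_apply hs,
    Measure.toSignedMeasure_sub_apply hs]
  apply Complex.ext <;> simp

end FourMeasures

/-! ### The Laplace transform of a finite positive measure -/

/-- The closed right half-plane. -/
abbrev ClosedHalfPlane : Type := {z : ℂ // 0 ≤ z.re}

/-- The Laplace transform of a positive measure. -/
def measureLaplace (m : Measure ℝ≥0) (z : ℂ) : ℂ :=
  ∫ s : ℝ≥0, Complex.exp (-((s : ℝ) : ℂ) * z) ∂m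

theorem norm_laplaceKernel_le {z : ℂ} (hz : 0 ≤ z.re) (s : ℝ≥0) :
    ‖Complex.exp (-((s : ℝ) : ℂ) * z)‖ ≤ 1 := by
  rw [Complex.norm_exp]
  simpa using mul_nonneg s.2 hz

theorem continuous_laplaceKernel (z : ℂ) :
    Continuous fun s : ℝ≥0 ↦ Complex.exp (-((s : ℝ) : ℂ) * z) := by
  fun_prop

theorem integrable_laplaceKernel (m : Measure ℝ≥0) [IsFiniteMeasure m] {z : ℂ} (hz : 0 ≤ z.re) :
    Integrable (fun s : ℝ≥0 ↦ Complex.exp (-((s : ℝ) : ℂ) * z)) m :=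
  Integrable.of_bound (continuous_laplaceKernel z).aestronglyMeasurable 1
    (Eventually.of_forall fun s ↦ norm_laplaceKernel_le hz s)

theorem differentiableOn_measureLaplace (m : Measure ℝ≥0) [IsFiniteMeasure m] :
    DifferentiableOn ℂ (measureLaplace m) {z | 0 < z.re} := by
  -- After `z ↦ -z` this is a complex moment generating function, holomorphic over the interior of
  -- the set of integrable exponents, which contains the negative axis.
  have h1 : measureLaplace m =
      fun z ↦ ProbabilityTheory.complexMGF (fun s : ℝ≥0 ↦ (s : ℝ)) m (-z) := by
    ext z
    simp [measureLaplace, ProbabilityTheory.complexMGF, mul_comm]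
  have h2 : Set.Iic (0 : ℝ) ⊆ ProbabilityTheory.integrableExpSet (fun s : ℝ≥0 ↦ (s : ℝ)) m := by
    intro t ht
    refine Integrable.of_bound (by fun_prop) 1 (Eventually.of_forall fun s ↦ ?_)
    rw [Real.norm_of_nonneg (Real.exp_nonneg _)]
    exact Real.exp_le_one_iff.mpr (mul_nonpos_of_nonpos_of_nonneg ht s.2)
  rw [h1]
  refine ProbabilityTheory.differentiableOn_complexMGF.comp (by fun_prop) fun z hz ↦ ?_
  refine interior_mono h2 ?_
  simpa using hz

theorem tendsto_measureLaplace (m : Measure ℝ≥0) [IsFiniteMeasure m] {z : ℂ} (hz : 0 ≤ z.re) :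
    Tendsto (fun ε : ℝ ↦ measureLaplace m (z + ε)) (𝓝[>] 0) (𝓝 (measureLaplace m z)) := by
  refine tendsto_integral_filter_of_dominated_convergence (fun _ ↦ 1)
    (Eventually.of_forall fun ε ↦ (continuous_laplaceKernel _).aestronglyMeasurable) ?_
    (integrable_const _) (Eventually.of_forall fun s ↦ ?_)
  · filter_upwards [self_mem_nhdsWithin] with ε hε
    refine Eventually.of_forall fun s ↦ norm_laplaceKernel_le ?_ s
    simpa using add_nonneg hz (le_of_lt hε)
  · have : Continuous fun ε : ℝ ↦ Complex.exp (-((s : ℝ) : ℂ) * (z + ε)) := by fun_prop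
    simpa using (this.tendsto 0).mono_left nhdsWithin_le_nhds

/-- The Laplace transform determines a finite measure. -/
theorem measure_eq_of_measureLaplace_eq (m m' : Measure ℝ≥0) [IsFiniteMeasure m]
    [IsFiniteMeasure m'] (h : ∀ z : ℂ, 0 < z.re → measureLaplace m z = measureLaplace m' z) :
    m = m' := by
  -- Continuity extends the equality to the imaginary axis, where it becomes an equality of
  -- characteristic functions.
  have h' (z : ℂ) (hz : 0 ≤ z.re) : measureLaplace m z = measureLaplace m' z := by
    refine tendsto_nhds_unique (tendsto_measureLaplace m hz) ?_
    refine (tendsto_measureLaplace m' hz).congr' ?_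
    filter_upwards [self_mem_nhdsWithin] with ε hε
    exact (h _ (by simpa using add_pos_of_nonneg_of_pos hz hε)).symm
  have hmap : m.map ((↑) : ℝ≥0 → ℝ) = m'.map ((↑) : ℝ≥0 → ℝ) := by
    refine Measure.ext_of_charFun ?_
    ext t
    rw [charFun_apply_real, charFun_apply_real,
      integral_map (by fun_prop) (by fun_prop), integral_map (by fun_prop) (by fun_prop)]
    have := h' (-(t * Complex.I)) (by simp)
    simpa [measureLaplace, mul_comm, mul_assoc, mul_left_comm] using this
  have hemb : MeasurableEmbedding ((↑) : ℝ≥0 → ℝ) :=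
    MeasurableEmbedding.subtype_coe measurableSet_Ici
  exact hemb.map_injective hmap

namespace BoundedC0Semigroup

variable {X : Type*} [NormedAddCommGroup X] [NormedSpace ℂ X]

/-! ### The Hille-Phillips calculus as an algebra of pairs -/

theorem exists_bound (T : BoundedC0Semigroup X) : ∃ M : ℝ, 0 ≤ M ∧ ∀ t, ‖T.toFun t‖ ≤ M := by
  obtain ⟨M, hM⟩ := T.bounded'
  exact ⟨M, (norm_nonneg _).trans (hM 0), hM⟩

theorem integrable_orbit_measure (T : BoundedC0Semigroup X) (m : Measure ℝ≥0) [IsFiniteMeasure m]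
    (x : X) : Integrable (fun s ↦ T.toFun s x) m := by
  obtain ⟨M, -, hM⟩ := T.exists_bound
  exact Integrable.of_bound (T.continuous' x).aestronglyMeasurable (M * ‖x‖)
    (Eventually.of_forall fun s ↦ (T.toFun s).le_of_opNorm_le (hM s) x)

theorem norm_integral_orbit_le (T : BoundedC0Semigroup X) {M : ℝ} (hM : ∀ t, ‖T.toFun t‖ ≤ M)
    (m : Measure ℝ≥0) [IsFiniteMeasure m] (x : X) :
    ‖∫ s, T.toFun s x ∂m‖ ≤ M * m.real Set.univ * ‖x‖ :=
  (norm_integral_le_of_norm_le_const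
    (Eventually.of_forall fun s ↦ (T.toFun s).le_of_opNorm_le (hM s) x)).trans
    (le_of_eq (by ring))

/-- The operator `x ↦ ∫ T(s) x m(ds)` for a finite positive measure `m`. -/
def measureOp (T : BoundedC0Semigroup X) (m : Measure ℝ≥0) [IsFiniteMeasure m] : X →L[ℂ] X :=
  LinearMap.mkContinuousOfExistsBound
    { toFun := fun x ↦ ∫ s, T.toFun s x ∂m
      map_add' := fun x y ↦ by
        simp only [map_add]
        exact integral_add (T.integrable_orbit_measure m x) (T.integrable_orbit_measure m y)
      map_smul' := fun c x ↦ by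
        simp only [map_smul, RingHom.id_apply]
        exact integral_smul c _ }
    (by
      obtain ⟨M, -, hM⟩ := T.exists_bound
      exact ⟨M * m.real Set.univ, T.norm_integral_orbit_le hM m⟩)

/-- The Laplace transform of a finite positive measure together with the corresponding operator. -/
def measurePair (T : BoundedC0Semigroup X) (m : Measure ℝ≥0) [IsFiniteMeasure m] :
    (ClosedHalfPlane → ℂ) × (X →L[ℂ] X) :=
  (fun z ↦ measureLaplace m z, T.measureOp m)

theorem measurePair_add (T : BoundedC0Semigroup X) (m m' : Measure ℝ≥0) [IsFiniteMeasure m]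
    [IsFiniteMeasure m'] : T.measurePair (m + m') = T.measurePair m + T.measurePair m' := by
  refine Prod.ext (funext fun z ↦ ?_) (ContinuousLinearMap.ext fun x ↦ ?_)
  · exact integral_add_measure (integrable_laplaceKernel m z.2) (integrable_laplaceKernel m' z.2)
  · exact integral_add_measure (T.integrable_orbit_measure m x) (T.integrable_orbit_measure m' x)

theorem measurePair_smul (T : BoundedC0Semigroup X) (c : ℝ≥0) (m : Measure ℝ≥0)
    [IsFiniteMeasure m] : T.measurePair (c • m) = ((c : ℝ) : ℂ) • T.measurePair m := by
  refine Prod.ext (funext fun z ↦ ?_) (ContinuousLinearMap.ext fun x ↦ ?_)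
  · exact (integral_smul_nnreal_measure _ c).trans (Complex.coe_smul _ _).symm
  · exact (integral_smul_nnreal_measure _ c).trans (Complex.coe_smul _ _).symm

/-- The functions of the Hille-Phillips calculus on the closed half-plane, each together with the
operator that it is mapped to. -/
def calculusAlgebra (T : BoundedC0Semigroup X) :
    Subalgebra ℂ ((ClosedHalfPlane → ℂ) × (X →L[ℂ] X)) :=
  Algebra.adjoin ℂ {F | ∃ (m : Measure ℝ≥0) (_ : IsFiniteMeasure m), F = T.measurePair m}

theorem measurePair_mem (T : BoundedC0Semigroup X) (m : Measure ℝ≥0) [IsFiniteMeasure m] :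
    T.measurePair m ∈ T.calculusAlgebra :=
  Algebra.subset_adjoin ⟨m, inferInstance, rfl⟩

/-- The push-forward of a finite measure under `r` belongs to the calculus. -/
theorem exists_mem_of_map (T : BoundedC0Semigroup X) {Ω : Type*} [MeasurableSpace Ω]
    (P : Measure Ω) [IsFiniteMeasure P] {r : Ω → ℝ≥0} (hr : Measurable r) :
    ∃ F ∈ T.calculusAlgebra,
      (∀ z, F.1 z = ∫ ω, Complex.exp (-((r ω : ℝ) : ℂ) * z) ∂P) ∧
      ∀ x, F.2 x = ∫ ω, T.toFun (r ω) x ∂P := by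
  refine ⟨_, T.measurePair_mem (P.map r), fun z ↦ ?_, fun x ↦ ?_⟩
  · exact integral_map hr.aemeasurable (continuous_laplaceKernel z).aestronglyMeasurable
  · exact integral_map hr.aemeasurable (T.continuous' x).aestronglyMeasurable

variable [CompleteSpace X]

theorem measurePair_dirac (T : BoundedC0Semigroup X) (t : ℝ≥0) :
    T.measurePair (Measure.dirac t) =
      (fun z : ClosedHalfPlane ↦ Complex.exp (-((t : ℝ) : ℂ) * z), T.toFun t) := by
  refine Prod.ext (funext fun z ↦ ?_) (ContinuousLinearMap.ext fun x ↦ ?_)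
  · exact integral_dirac _ t
  · exact integral_dirac _ t

theorem dirac_mem (T : BoundedC0Semigroup X) (t : ℝ≥0) :
    ((fun z : ClosedHalfPlane ↦ Complex.exp (-((t : ℝ) : ℂ) * z), T.toFun t) :
      (ClosedHalfPlane → ℂ) × (X →L[ℂ] X)) ∈ T.calculusAlgebra :=
  T.measurePair_dirac t ▸ T.measurePair_mem _

/-- Fubini, together with the factorization of both `e^{-(s+t)z}` and `T(s+t)`. -/
theorem measurePair_conv (T : BoundedC0Semigroup X) (m m' : Measure ℝ≥0) [IsFiniteMeasure m]
    [IsFiniteMeasure m'] : T.measurePair (m ∗ m') = T.measurePair m * T.measurePair m' := by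
  refine Prod.ext (funext fun z ↦ ?_) (ContinuousLinearMap.ext fun x ↦ ?_)
  · change ∫ s : ℝ≥0, _ ∂(m ∗ m') = (∫ s : ℝ≥0, _ ∂m) * measureLaplace m' z
    rw [integral_conv (integrable_laplaceKernel _ z.2), ← integral_mul_const (measureLaplace m' z)]
    congr 1
    ext s
    change _ = _ * ∫ s : ℝ≥0, _ ∂m'
    rw [← integral_const_mul]
    congr 1
    ext t
    rw [← Complex.exp_add]
    push_cast
    ring_nf
  · change ∫ s : ℝ≥0, _ ∂(m ∗ m') = ∫ s, T.toFun s (∫ t, T.toFun t x ∂m') ∂m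
    rw [integral_conv (T.integrable_orbit_measure _ x)]
    congr 1
    ext s
    rw [← ContinuousLinearMap.integral_comp_comm _ (T.integrable_orbit_measure m' x)]
    simp [T.map_add']

/-- Under convolution, with unit the Dirac mass at `0`, the generators already form a monoid, so
generating an algebra adds only linear combinations. -/
theorem calculusAlgebra_eq_span (T : BoundedC0Semigroup X) :
    Subalgebra.toSubmodule T.calculusAlgebra =
      Submodule.span ℂ {F | ∃ (m : Measure ℝ≥0) (_ : IsFiniteMeasure m), F = T.measurePair m} := by
  have h1 : (1 : (ClosedHalfPlane → ℂ) × (X →L[ℂ] X)) = T.measurePair (Measure.dirac 0) := by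
    rw [measurePair_dirac]
    refine Prod.ext (funext fun z ↦ ?_) ?_
    · simp
    · exact T.map_zero'.symm
  let N : Submonoid ((ClosedHalfPlane → ℂ) × (X →L[ℂ] X)) :=
    { carrier := {F | ∃ (m : Measure ℝ≥0) (_ : IsFiniteMeasure m), F = T.measurePair m}
      one_mem' := ⟨_, inferInstance, h1⟩
      mul_mem' := by
        rintro _ _ ⟨m, hm, rfl⟩ ⟨m', hm', rfl⟩
        exact ⟨m ∗ m', inferInstance, (T.measurePair_conv m m').symm⟩ }
  rw [calculusAlgebra, Algebra.adjoin_eq_span]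
  exact congrArg (fun Q : Submonoid ((ClosedHalfPlane → ℂ) × (X →L[ℂ] X)) ↦
    Submodule.span ℂ (Q : Set ((ClosedHalfPlane → ℂ) × (X →L[ℂ] X)))) N.closure_eq

/-- Every element of the calculus is given by four finite positive measures. -/
theorem exists_measures_of_mem (T : BoundedC0Semigroup X) {F : (ClosedHalfPlane → ℂ) × (X →L[ℂ] X)}
    (hF : F ∈ T.calculusAlgebra) :
    ∃ (m₁ m₂ m₃ m₄ : Measure ℝ≥0) (_ : IsFiniteMeasure m₁) (_ : IsFiniteMeasure m₂)
      (_ : IsFiniteMeasure m₃) (_ : IsFiniteMeasure m₄),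
      F = (T.measurePair m₁ - T.measurePair m₂) +
        Complex.I • (T.measurePair m₃ - T.measurePair m₄) := by
  have hz : T.measurePair 0 = 0 := by simpa using T.measurePair_smul 0 0
  rw [← Subalgebra.mem_toSubmodule, calculusAlgebra_eq_span] at hF
  induction hF using Submodule.span_induction with
  | mem F h =>
    obtain ⟨m, hm, rfl⟩ := h
    exact ⟨m, 0, 0, 0, hm, inferInstance, inferInstance, inferInstance, by simp [hz]⟩
  | zero =>
    exact ⟨0, 0, 0, 0, inferInstance, inferInstance, inferInstance, inferInstance, by simp [hz]⟩
  | add F G _ _ hF hG =>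
    obtain ⟨m₁, m₂, m₃, m₄, _, _, _, _, rfl⟩ := hF
    obtain ⟨n₁, n₂, n₃, n₄, _, _, _, _, rfl⟩ := hG
    refine ⟨m₁ + n₁, m₂ + n₂, m₃ + n₃, m₄ + n₄, inferInstance, inferInstance, inferInstance,
      inferInstance, ?_⟩
    simp only [measurePair_add]
    module
  | smul c F _ hF =>
    obtain ⟨m₁, m₂, m₃, m₄, _, _, _, _, rfl⟩ := hF
    have hc : c = (((c.re.toNNReal : ℝ) : ℂ) - (((-c.re).toNNReal : ℝ) : ℂ)) +
        Complex.I * (((c.im.toNNReal : ℝ) : ℂ) - (((-c.im).toNNReal : ℝ) : ℂ)) := by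
      rw [← Complex.ofReal_sub, ← Complex.ofReal_sub, Real.coe_toNNReal', Real.coe_toNNReal',
        Real.coe_toNNReal', Real.coe_toNNReal', max_zero_sub_eq_self, max_zero_sub_eq_self, mul_comm]
      exact (Complex.re_add_im c).symm
    generalize c.re.toNNReal = a at hc
    generalize (-c.re).toNNReal = a' at hc
    generalize c.im.toNNReal = b at hc
    generalize (-c.im).toNNReal = b' at hc
    -- Multiplication by `i` moves the real pair to the imaginary one, and the imaginary pair, with
    -- its order reversed, to the real one.
    refine ⟨a • m₁ + a' • m₂ + b • m₄ + b' • m₃, a • m₂ + a' • m₁ + b • m₃ + b' • m₄,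
      a • m₃ + a' • m₄ + b • m₁ + b' • m₂, a • m₄ + a' • m₃ + b • m₂ + b' • m₁,
      inferInstance, inferInstance, inferInstance, inferInstance, ?_⟩
    simp only [measurePair_add, measurePair_smul]
    rw [hc]
    have hI := Complex.I_mul_I
    match_scalars
    · ring
    · ring
    · linear_combination (((b : ℝ) : ℂ) - ((b' : ℝ) : ℂ)) * hI
    · linear_combination -(((b : ℝ) : ℂ) - ((b' : ℝ) : ℂ)) * hI

/-! ### Complex measures as elements of the calculus, and uniqueness -/

theorem laplaceTransform_eq_of_apply_eq (μ : ComplexMeasure ℝ≥0) (m₁ m₂ m₃ m₄ : Measure ℝ≥0)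
    [IsFiniteMeasure m₁] [IsFiniteMeasure m₂] [IsFiniteMeasure m₃] [IsFiniteMeasure m₄]
    (hμ : ∀ s, MeasurableSet s →
      μ s = ((m₁.real s - m₂.real s : ℝ) : ℂ) + Complex.I * ((m₃.real s - m₄.real s : ℝ) : ℂ))
    {T : BoundedC0Semigroup X} :
    (fun z : ClosedHalfPlane ↦ laplaceTransform μ z, T.hillePhillips μ) =
      (T.measurePair m₁ - T.measurePair m₂) +
        Complex.I • (T.measurePair m₃ - T.measurePair m₄) := by
  obtain ⟨M, -, hM⟩ := T.exists_bound
  refine Prod.ext (funext fun z ↦ ?_) (ContinuousLinearMap.ext fun x ↦ ?_)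
  · exact complexIntegral_eq_of_apply_eq μ m₁ m₂ m₃ m₄ hμ
      (continuous_laplaceKernel z).stronglyMeasurable (norm_laplaceKernel_le z.2)
  · exact complexIntegral_eq_of_apply_eq μ m₁ m₂ m₃ m₄ hμ
      (T.continuous' x).stronglyMeasurable fun s ↦ (T.toFun s).le_of_opNorm_le (hM s) x

theorem complexMeasure_mem (T : BoundedC0Semigroup X) (μ : ComplexMeasure ℝ≥0) :
    ((fun z : ClosedHalfPlane ↦ laplaceTransform μ z, T.hillePhillips μ) :
      (ClosedHalfPlane → ℂ) × (X →L[ℂ] X)) ∈ T.calculusAlgebra := by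
  obtain ⟨m₁, m₂, m₃, m₄, _, _, _, _, hμ⟩ := exists_measures_of_complexMeasure μ
  rw [laplaceTransform_eq_of_apply_eq μ m₁ m₂ m₃ m₄ hμ]
  exact add_mem (sub_mem (T.measurePair_mem _) (T.measurePair_mem _))
    (T.calculusAlgebra.smul_mem (sub_mem (T.measurePair_mem _) (T.measurePair_mem _)) _)

theorem exists_complexMeasure_of_mem (T : BoundedC0Semigroup X)
    {F : (ClosedHalfPlane → ℂ) × (X →L[ℂ] X)} (hF : F ∈ T.calculusAlgebra) :
    ∃ μ : ComplexMeasure ℝ≥0,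
      (∀ z : ClosedHalfPlane, laplaceTransform μ z = F.1 z) ∧ T.hillePhillips μ = F.2 := by
  obtain ⟨m₁, m₂, m₃, m₄, _, _, _, _, rfl⟩ := T.exists_measures_of_mem hF
  obtain ⟨μ, hμ⟩ := exists_complexMeasure_of_measures m₁ m₂ m₃ m₄
  have h := laplaceTransform_eq_of_apply_eq μ m₁ m₂ m₃ m₄ hμ (T := T)
  exact ⟨μ, fun z ↦ congrFun (congrArg Prod.fst h) z, congrArg Prod.snd h⟩

theorem measureLaplace_conj (m : Measure ℝ≥0) (z : ℂ) :
    measureLaplace m ((starRingEnd ℂ) z) = (starRingEnd ℂ) (measureLaplace m z) := by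
  rw [measureLaplace, measureLaplace, ← integral_conj]
  congr 1
  ext s
  rw [← Complex.exp_conj]
  simp

/-- The operator of an element of the calculus is determined by the values of the function on the
open right half-plane. -/
theorem snd_eq_zero_of_fst_eq_zero (T : BoundedC0Semigroup X)
    {F : (ClosedHalfPlane → ℂ) × (X →L[ℂ] X)} (hF : F ∈ T.calculusAlgebra)
    (h : ∀ z : ClosedHalfPlane, 0 < z.1.re → F.1 z = 0) : F.2 = 0 := by
  obtain ⟨m₁, m₂, m₃, m₄, _, _, _, _, rfl⟩ := T.exists_measures_of_mem hF
  have h0 (z : ℂ) (hz : 0 < z.re) : (measureLaplace m₁ z - measureLaplace m₂ z) +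
      Complex.I * (measureLaplace m₃ z - measureLaplace m₄ z) = 0 := h ⟨z, hz.le⟩ hz
  -- Laplace transforms of positive measures commute with conjugation; conjugating the identity at
  -- `z̄` therefore separates the two signed measures.
  have h1 (z : ℂ) (hz : 0 < z.re) : (measureLaplace m₁ z - measureLaplace m₂ z) -
      Complex.I * (measureLaplace m₃ z - measureLaplace m₄ z) = 0 := by
    have := congrArg (starRingEnd ℂ) (h0 ((starRingEnd ℂ) z) (by simpa using hz))
    simpa [measureLaplace_conj, sub_eq_add_neg] using this
  have e₁ : m₁ = m₂ := measure_eq_of_measureLaplace_eq _ _ fun z hz ↦ by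
    linear_combination (h0 z hz + h1 z hz) / 2
  have e₂ : m₃ = m₄ := measure_eq_of_measureLaplace_eq _ _ fun z hz ↦ by
    linear_combination (-Complex.I) * (h0 z hz - h1 z hz) / 2 +
      (measureLaplace m₃ z - measureLaplace m₄ z) * Complex.I_mul_I
  subst e₁ e₂
  simp

theorem snd_eq_of_fst_eq (T : BoundedC0Semigroup X)
    {F G : (ClosedHalfPlane → ℂ) × (X →L[ℂ] X)} (hF : F ∈ T.calculusAlgebra)
    (hG : G ∈ T.calculusAlgebra) (h : ∀ z : ClosedHalfPlane, 0 < z.1.re → F.1 z = G.1 z) :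
    F.2 = G.2 :=
  sub_eq_zero.mp (T.snd_eq_zero_of_fst_eq_zero (sub_mem hF hG) fun z hz ↦ by simp [h z hz])

theorem commute_of_mem (T : BoundedC0Semigroup X)
    {F G : (ClosedHalfPlane → ℂ) × (X →L[ℂ] X)} (hF : F ∈ T.calculusAlgebra)
    (hG : G ∈ T.calculusAlgebra) : F.2 * G.2 = G.2 * F.2 :=
  T.snd_eq_of_fst_eq (mul_mem hF hG) (mul_mem hG hF) fun z _ ↦ mul_comm (F.1 z) (G.1 z)

theorem exists_differentiableOn_of_mem (T : BoundedC0Semigroup X)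
    {F : (ClosedHalfPlane → ℂ) × (X →L[ℂ] X)} (hF : F ∈ T.calculusAlgebra) :
    ∃ g : ℂ → ℂ, DifferentiableOn ℂ g {z | 0 < z.re} ∧ ∀ z : ClosedHalfPlane, g z = F.1 z := by
  obtain ⟨m₁, m₂, m₃, m₄, _, _, _, _, rfl⟩ := T.exists_measures_of_mem hF
  refine ⟨fun z ↦ (measureLaplace m₁ z - measureLaplace m₂ z) +
      Complex.I * (measureLaplace m₃ z - measureLaplace m₄ z), ?_, fun z ↦ rfl⟩
  exact ((differentiableOn_measureLaplace _).sub (differentiableOn_measureLaplace _)).add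
    (((differentiableOn_measureLaplace _).sub (differentiableOn_measureLaplace _)).const_mul _)

end BoundedC0Semigroup

/-! ### Some elements of the calculus -/

/-- The exponential distribution. -/
def exponentialLaw : Measure ℝ :=
  (volume.restrict (Set.Ioi 0)).withDensity fun u ↦ ENNReal.ofReal (Real.exp (-u))

instance : IsFiniteMeasure exponentialLaw :=
  isFiniteMeasure_withDensity_ofReal (integrableOn_exp_neg_Ioi 0).hasFiniteIntegral

theorem integral_exponentialLaw_exp {c : ℂ} (hc : 0 ≤ c.re) :
    ∫ u, Complex.exp (-((u.toNNReal : ℝ) : ℂ) * c) ∂exponentialLaw = (1 + c)⁻¹ := by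
  rw [exponentialLaw, integral_withDensity_eq_integral_toReal_smul (by fun_prop) (by simp)]
  have h1 : ∀ u ∈ Set.Ioi (0 : ℝ), (ENNReal.ofReal (Real.exp (-u))).toReal •
      Complex.exp (-((u.toNNReal : ℝ) : ℂ) * c) = Complex.exp (-(1 + c) * u) := by
    intro u hu
    rw [ENNReal.toReal_ofReal (Real.exp_nonneg _), Real.coe_toNNReal u (le_of_lt hu),
      Complex.real_smul, Complex.ofReal_exp, ← Complex.exp_add]
    push_cast
    ring_nf
  rw [setIntegral_congr_fun measurableSet_Ioi h1,
    integral_exp_mul_complex_Ioi (by simp; linarith)]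
  simp only [Complex.ofReal_zero, mul_zero, Complex.exp_zero, neg_div_neg_eq, one_div]

theorem exponentialLaw_real_univ : exponentialLaw.real Set.univ = 1 := by
  have := integral_exponentialLaw_exp (c := 0) le_rfl
  simpa using this

theorem integral_exp_neg_mul (c : ℂ) :
    c * ∫ v in Set.Ioc (0 : ℝ) 1, Complex.exp (-((v.toNNReal : ℝ) : ℂ) * c) =
      1 - Complex.exp (-c) := by
  have h1 : ∀ v ∈ Set.Ioc (0 : ℝ) 1, Complex.exp (-((v.toNNReal : ℝ) : ℂ) * c) =
      Complex.exp (-(v : ℂ) * c) := fun v hv ↦ by rw [Real.coe_toNNReal v hv.1.le]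
  have h2 (x : ℝ) : HasDerivAt (fun v : ℝ ↦ -Complex.exp (-(v : ℂ) * c))
      (c * Complex.exp (-(x : ℂ) * c)) x := by
    have h3 : HasDerivAt (fun v : ℝ ↦ -(v : ℂ) * c) (-1 * c) x :=
      (hasDerivAt_id x).ofReal_comp.neg.mul_const c
    exact h3.cexp.neg.congr_deriv (by ring)
  rw [setIntegral_congr_fun measurableSet_Ioc h1, ← integral_const_mul,
    ← intervalIntegral.integral_of_le zero_le_one,
    intervalIntegral.integral_eq_sub_of_hasDerivAt (fun x _ ↦ h2 x)
      (Continuous.intervalIntegrable (by fun_prop) _ _)]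
  simp [neg_add_eq_sub]

/-- The combined integrand has primitive `(v - 1) e^{-vc}`. Thus the second-order remainder of
`e^{-c}` at `0` is again given by a positive density, which later supplies the double zero of the
Euler error. -/
theorem integral_one_sub_mul_exp_neg_mul (c : ℂ) :
    c * ∫ v in Set.Ioc (0 : ℝ) 1, ((1 - v : ℝ) : ℂ) * Complex.exp (-((v.toNNReal : ℝ) : ℂ) * c) =
      1 - ∫ v in Set.Ioc (0 : ℝ) 1, Complex.exp (-((v.toNNReal : ℝ) : ℂ) * c) := by
  have h1 : ∀ v ∈ Set.Ioc (0 : ℝ) 1, ((1 - v : ℝ) : ℂ) * Complex.exp (-((v.toNNReal : ℝ) : ℂ) * c) =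
      ((1 - v : ℝ) : ℂ) * Complex.exp (-(v : ℂ) * c) :=
    fun v hv ↦ by rw [Real.coe_toNNReal v hv.1.le]
  have h1' : ∀ v ∈ Set.Ioc (0 : ℝ) 1, Complex.exp (-((v.toNNReal : ℝ) : ℂ) * c) =
      Complex.exp (-(v : ℂ) * c) := fun v hv ↦ by rw [Real.coe_toNNReal v hv.1.le]
  have h2 (x : ℝ) : HasDerivAt (fun v : ℝ ↦ ((v - 1 : ℝ) : ℂ) * Complex.exp (-(v : ℂ) * c))
      (Complex.exp (-(x : ℂ) * c) + c * (((1 - x : ℝ) : ℂ) * Complex.exp (-(x : ℂ) * c))) x := by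
    have h3 : HasDerivAt (fun v : ℝ ↦ -(v : ℂ) * c) (-1 * c) x :=
      (hasDerivAt_id x).ofReal_comp.neg.mul_const c
    have h4 : HasDerivAt (fun v : ℝ ↦ ((v - 1 : ℝ) : ℂ)) 1 x :=
      ((hasDerivAt_id x).sub_const 1).ofReal_comp
    exact (h4.mul h3.cexp).congr_deriv (by push_cast; ring)
  rw [setIntegral_congr_fun measurableSet_Ioc h1, setIntegral_congr_fun measurableSet_Ioc h1',
    eq_sub_iff_add_eq', ← integral_const_mul,
    ← intervalIntegral.integral_of_le zero_le_one, ← intervalIntegral.integral_of_le zero_le_one,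
    ← intervalIntegral.integral_add (Continuous.intervalIntegrable (by fun_prop) _ _)
      (Continuous.intervalIntegrable (by fun_prop) _ _),
    intervalIntegral.integral_eq_sub_of_hasDerivAt (fun x _ ↦ h2 x)
      (Continuous.intervalIntegrable (by fun_prop) _ _)]
  simp

/-! ### Resolvent functions and divided differences of the exponential -/

namespace BoundedC0Semigroup

variable {X : Type*} [NormedAddCommGroup X] [NormedSpace ℂ X]

/-- The measure is the image of the exponential law under `u ↦ hu`; its total mass `1` gives the
norm bound, uniform in `h`. -/
theorem exists_mem_inv_one_add (T : BoundedC0Semigroup X) (h : ℝ≥0) :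
    ∃ F ∈ T.calculusAlgebra, (∀ z, F.1 z = (1 + ((h : ℝ) : ℂ) * z)⁻¹) ∧
      ∀ M, (∀ t, ‖T.toFun t‖ ≤ M) → ‖F.2‖ ≤ M := by
  obtain ⟨F, hF, hF1, hF2⟩ := T.exists_mem_of_map exponentialLaw (r := fun u ↦ h * u.toNNReal)
    (by fun_prop)
  refine ⟨F, hF, fun z ↦ ?_, fun M hM ↦ ?_⟩
  · rw [hF1, ← integral_exponentialLaw_exp (by simpa using mul_nonneg h.2 z.2)]
    congr 1
    ext u
    push_cast
    ring_nf
  · refine F.2.opNorm_le_bound ((norm_nonneg _).trans (hM 0)) fun x ↦ ?_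
    rw [hF2]
    refine (norm_integral_le_of_norm_le_const
      (Eventually.of_forall fun u ↦ (T.toFun _).le_of_opNorm_le (hM _) x)).trans ?_
    rw [exponentialLaw_real_univ, mul_one]

/-- Fubini for a mixture of exponential laws. It serves Stieltjes integrals through `τ / (z + τ) =
(1 + z/τ)⁻¹`. -/
theorem exists_mem_integral_inv_one_add (T : BoundedC0Semigroup X) (ρ : Measure ℝ≥0)
    [IsFiniteMeasure ρ] :
    ∃ F ∈ T.calculusAlgebra, ∀ z, F.1 z = ∫ h : ℝ≥0, (1 + ((h : ℝ) : ℂ) * z)⁻¹ ∂ρ := by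
  obtain ⟨F, hF, hF1, -⟩ := T.exists_mem_of_map (ρ.prod exponentialLaw)
    (r := fun p ↦ p.1 * p.2.toNNReal) (by fun_prop)
  refine ⟨F, hF, fun z ↦ ?_⟩
  rw [hF1, integral_prod]
  · congr 1
    ext h
    rw [← integral_exponentialLaw_exp (by simpa using mul_nonneg h.2 z.2)]
    congr 1
    ext u
    push_cast
    ring_nf
  · exact Integrable.of_bound (by fun_prop) 1
      (Eventually.of_forall fun p ↦ norm_laplaceKernel_le z.2 _)

/-- `F` and `G` are the first two divided differences of `e^{-hz}` at `0`, with densities `1` and `1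
- v`. The form without division also covers `hz = 0`. -/
theorem exists_mem_average (T : BoundedC0Semigroup X) (h : ℝ≥0) :
    ∃ F ∈ T.calculusAlgebra, ∃ G ∈ T.calculusAlgebra,
      (∀ z, ((h : ℝ) : ℂ) * z * F.1 z = 1 - Complex.exp (-((h : ℝ) : ℂ) * z)) ∧
      (∀ z, ((h : ℝ) : ℂ) * z * G.1 z = 1 - F.1 z) ∧
      ∀ x, F.2 x = ∫ v in Set.Ioc (0 : ℝ) 1, T.toFun (h * v.toNNReal) x := by
  obtain ⟨F, hF, hF1, hF2⟩ := T.exists_mem_of_map (volume.restrict (Set.Ioc (0 : ℝ) 1))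
    (r := fun v ↦ h * v.toNNReal) (by fun_prop)
  have hfin : IsFiniteMeasure ((volume.restrict (Set.Ioc (0 : ℝ) 1)).withDensity
      fun v ↦ ENNReal.ofReal (1 - v)) :=
    isFiniteMeasure_withDensity_ofReal
      (Continuous.integrableOn_Ioc (f := fun v : ℝ ↦ 1 - v) (by fun_prop)).hasFiniteIntegral
  obtain ⟨G, hG, hG1, -⟩ := T.exists_mem_of_map ((volume.restrict (Set.Ioc (0 : ℝ) 1)).withDensity
      fun v ↦ ENNReal.ofReal (1 - v))
    (r := fun v ↦ h * v.toNNReal) (by fun_prop)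
  have e (z : ℂ) (v : ℝ) : Complex.exp (-(((h * v.toNNReal : ℝ≥0) : ℝ) : ℂ) * z) =
      Complex.exp (-((v.toNNReal : ℝ) : ℂ) * (((h : ℝ) : ℂ) * z)) := by
    push_cast
    ring_nf
  refine ⟨F, hF, G, hG, fun z ↦ ?_, fun z ↦ ?_, hF2⟩
  · rw [neg_mul, ← integral_exp_neg_mul]
    simp only [hF1, e]
  · rw [hF1, hG1, integral_withDensity_eq_integral_toReal_smul (by fun_prop) (by simp)]
    simp only [e]
    rw [← integral_one_sub_mul_exp_neg_mul]
    congr 1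
    refine setIntegral_congr_fun measurableSet_Ioc fun v hv ↦ ?_
    rw [ENNReal.toReal_ofReal (by linarith [hv.2]), Complex.real_smul]

end BoundedC0Semigroup

namespace BoundedC0Semigroup

variable {X : Type*} [NormedAddCommGroup X] [NormedSpace ℂ X]

/-! ### Resolvents of the generator -/

theorem IsGenerator.mem_graph_iff {T : BoundedC0Semigroup X} {A : X →ₗ.[ℂ] X}
    (hA : T.IsGenerator (-A)) {x y : X} : (x, y) ∈ A.graph ↔
      Tendsto (fun k : ℝ≥0 ↦ (k : ℝ)⁻¹ • (T.toFun k x - x)) (𝓝[>] 0) (𝓝 (-y)) := by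
  rw [← hA x (-y), LinearPMap.mem_graph_iff, LinearPMap.mem_graph_iff]
  constructor
  · rintro ⟨u, hu, hy⟩
    exact ⟨u, hu, by simpa using hy⟩
  · rintro ⟨u, hu, hy⟩
    exact ⟨u, hu, by simpa using hy⟩

/-- The mean of `T` over `[0, k]`. -/
def average (T : BoundedC0Semigroup X) (k : ℝ≥0) (x : X) : X :=
  ∫ v in Set.Ioc (0 : ℝ) 1, T.toFun (k * v.toNNReal) x

theorem norm_average_le (T : BoundedC0Semigroup X) {M : ℝ} (hM : ∀ t, ‖T.toFun t‖ ≤ M) (k : ℝ≥0)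
    (x : X) : ‖T.average k x‖ ≤ M * ‖x‖ := by
  refine (norm_integral_le_of_norm_le_const (Eventually.of_forall fun v : ℝ ↦
    (T.toFun (k * v.toNNReal)).le_of_opNorm_le (hM _) x)).trans ?_
  simp

/-- `Q` is the operator of the function `z ↦ 1 / (1 + h z)`. -/
def IsEulerOp (T : BoundedC0Semigroup X) (h : ℝ≥0) (Q : X →L[ℂ] X) : Prop :=
  ∃ F ∈ T.calculusAlgebra, (∀ z, F.1 z = (1 + ((h : ℝ) : ℂ) * z)⁻¹) ∧ F.2 = Q

theorem one_add_mul_ne_zero (h : ℝ≥0) (z : ClosedHalfPlane) : 1 + ((h : ℝ) : ℂ) * z ≠ 0 := by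
  intro h0
  have := congrArg Complex.re h0
  simp at this
  have h2 : 0 ≤ (h : ℝ) * z.1.re := mul_nonneg h.2 z.2
  linarith

theorem exists_isEulerOp (T : BoundedC0Semigroup X) (h : ℝ≥0) :
    ∃ Q, T.IsEulerOp h Q ∧ ∀ M, (∀ t, ‖T.toFun t‖ ≤ M) → ‖Q‖ ≤ M := by
  obtain ⟨F, hF, hF1, hF2⟩ := T.exists_mem_inv_one_add h
  exact ⟨F.2, ⟨F, hF, hF1, rfl⟩, hF2⟩

theorem toFun_nsmul (T : BoundedC0Semigroup X) (n : ℕ) (h : ℝ≥0) :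
    T.toFun (n • h) = T.toFun h ^ n := by
  induction n with
  | zero => simpa [ContinuousLinearMap.one_def] using T.map_zero'
  | succ n ih => rw [succ_nsmul, T.map_add', ih, pow_succ]; rfl

variable [CompleteSpace X]

theorem tendsto_average (T : BoundedC0Semigroup X) (x : X) :
    Tendsto (fun k ↦ T.average k x) (𝓝[>] 0) (𝓝 x) := by
  obtain ⟨M, -, hM⟩ := T.exists_bound
  have h1 : x = ∫ _v in Set.Ioc (0 : ℝ) 1, x := by simp
  conv => enter [3]; rw [h1]
  refine tendsto_integral_filter_of_dominated_convergence (fun _ ↦ M * ‖x‖)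
    (Eventually.of_forall fun k ↦ ?_)
    (Eventually.of_forall fun k ↦ Eventually.of_forall fun v ↦
      (T.toFun _).le_of_opNorm_le (hM _) x) (integrable_const _)
    (Eventually.of_forall fun v ↦ ?_)
  · exact ((T.continuous' x).comp (by fun_prop : Continuous fun v : ℝ ↦ k * v.toNNReal)).aestronglyMeasurable
  · have h2 : Continuous fun k : ℝ≥0 ↦ T.toFun (k * v.toNNReal) x :=
      (T.continuous' x).comp (by fun_prop)
    have h3 := (h2.tendsto 0).mono_left (nhdsWithin_le_nhds (s := Set.Ioi 0))
    simpa [T.map_zero'] using h3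

namespace IsEulerOp

variable {T : BoundedC0Semigroup X} {h : ℝ≥0} {Q : X →L[ℂ] X}

/-- Transfer to operators of `1 - e^{-kz} = kz W(z)`, with `W` the first divided difference,
multiplied by `(1 + hz)⁻¹`; here `z / (1 + hz) = h⁻¹ (1 - (1 + hz)⁻¹)`. Dividing by `k → 0` then
shows that `Q` maps into `dom A`. -/
theorem semigroup_sub (hQ : T.IsEulerOp h Q) (hh : 0 < h) (k : ℝ≥0) (y : X) :
    T.toFun k (Q y) - Q y = -((k : ℝ) : ℂ) • T.average k (((h : ℝ) : ℂ)⁻¹ • (y - Q y)) := by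
  obtain ⟨F, hF, hF1, rfl⟩ := hQ
  obtain ⟨G, hG, -, -, hG1, -, hG2⟩ := T.exists_mem_average k
  have hh0 : ((h : ℝ) : ℂ) ≠ 0 := by exact_mod_cast hh.ne'
  have hl := mul_mem (sub_mem (T.dirac_mem k) (one_mem _)) hF
  have hr := T.calculusAlgebra.smul_mem
    (mul_mem hG (T.calculusAlgebra.smul_mem (sub_mem (one_mem _) hF) ((h : ℝ) : ℂ)⁻¹))
    (-((k : ℝ) : ℂ))
  have := T.snd_eq_of_fst_eq hl hr fun z _ ↦ ?_
  · have := congrArg (fun B : X →L[ℂ] X ↦ B y) this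
    have hG3 (x : X) : G.2 x = T.average k x := hG2 x
    rw [← hG3]
    exact this
  · have h1 := hG1 z
    have h2 := one_add_mul_ne_zero h z
    simp only [Prod.fst_mul, Prod.fst_sub, Prod.fst_one, Prod.smul_fst, Pi.mul_apply, Pi.sub_apply,
      Pi.one_apply, Pi.smul_apply, hF1, smul_eq_mul]
    have h3 : ((h : ℝ) : ℂ)⁻¹ * (1 - (1 + ((h : ℝ) : ℂ) * z)⁻¹) =
        z * (1 + ((h : ℝ) : ℂ) * z)⁻¹ := by
      rw [inv_mul_eq_iff_eq_mul₀ hh0, ← mul_assoc, sub_eq_iff_eq_add, ← add_one_mul,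
        add_comm _ (1 : ℂ), mul_inv_cancel₀ h2]
    rw [h3]
    linear_combination (1 + ((h : ℝ) : ℂ) * z)⁻¹ * h1

variable {A : X →ₗ.[ℂ] X}

theorem mem_graph (hQ : T.IsEulerOp h Q) (hA : T.IsGenerator (-A)) (hh : 0 < h) (y : X) :
    (Q y, ((h : ℝ) : ℂ)⁻¹ • (y - Q y)) ∈ A.graph := by
  rw [hA.mem_graph_iff]
  refine (T.tendsto_average (((h : ℝ) : ℂ)⁻¹ • (y - Q y))).neg.congr' ?_
  filter_upwards [self_mem_nhdsWithin] with k hk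
  have hk0 : (k : ℝ) ≠ 0 := by exact_mod_cast (ne_of_gt hk)
  rw [hQ.semigroup_sub hh, neg_smul, smul_neg, Complex.coe_smul, smul_smul, inv_mul_cancel₀ hk0,
    one_smul]

/-- `Q` commutes with the semigroup, hence with `A`; so `Q y = A Q x`, which `mem_graph` also
computes as `h⁻¹ (x - Q x)`. -/
theorem apply_add (hQ : T.IsEulerOp h Q) (hA : T.IsGenerator (-A)) (hh : 0 < h) {x y : X}
    (hxy : (x, y) ∈ A.graph) : Q (x + ((h : ℝ) : ℂ) • y) = x := by
  have hh0 : ((h : ℝ) : ℂ) ≠ 0 := by exact_mod_cast hh.ne'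
  have h1 : (Q x, Q y) ∈ A.graph := by
    rw [hA.mem_graph_iff] at hxy ⊢
    refine (((Q.continuous.tendsto _).comp hxy).congr fun k ↦ ?_).trans (by rw [map_neg])
    obtain ⟨F, hF, -, rfl⟩ := hQ
    have : F.2 (T.toFun k x) = T.toFun k (F.2 x) :=
      congrArg (fun B : X →L[ℂ] X ↦ B x) (T.commute_of_mem hF (T.dirac_mem k))
    simp only [Function.comp_apply]
    rw [← Complex.coe_smul, ← Complex.coe_smul]
    simp only [map_smul, map_sub, this]
  have h2 : Q y = ((h : ℝ) : ℂ)⁻¹ • (x - Q x) :=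
    A.mem_graph_snd_inj h1 (hQ.mem_graph hA hh x) rfl
  rw [map_add, map_smul, h2, smul_smul, mul_inv_cancel₀ hh0, one_smul, add_sub_cancel]

end IsEulerOp

/-- Since `x = Q (x + y)` for `h = 1`, `semigroup_sub` gives `T(k)x - x` as `-k` times the mean of
`T(·)y` over `[0, k]`. -/
theorem IsGenerator.norm_semigroup_sub_le {T : BoundedC0Semigroup X} {A : X →ₗ.[ℂ] X}
    (hA : T.IsGenerator (-A)) {M : ℝ} (hM : ∀ t, ‖T.toFun t‖ ≤ M) {x y : X}
    (hxy : (x, y) ∈ A.graph) (k : ℝ≥0) : ‖T.toFun k x - x‖ ≤ k * (M * ‖y‖) := by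
  obtain ⟨Q, hQ, -⟩ := T.exists_isEulerOp 1
  have h1 : Q (x + y) = x := by simpa using hQ.apply_add hA one_pos hxy
  have h2 := hQ.semigroup_sub one_pos k (x + y)
  rw [h1] at h2
  rw [h2, norm_smul]
  have h3 : ((1 : ℝ≥0) : ℝ) = 1 := rfl
  simpa [h3] using mul_le_mul_of_nonneg_left (T.norm_average_le hM k y) k.2

end BoundedC0Semigroup

/-! ### Bounded inverses -/

section BoundedInverse

variable {X : Type*} [NormedAddCommGroup X] [NormedSpace ℂ X]

theorem isBoundedInverse_vadd_smul_iff (A : X →ₗ.[ℂ] X) (c d : ℂ) (R : X →L[ℂ] X) :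
    IsBoundedInverse ((c • LinearMap.id : X →ₗ[ℂ] X) +ᵥ (d • A)) R ↔
      (∀ y, ∃ w, (R y, w) ∈ A.graph ∧ c • R y + d • w = y) ∧
        ∀ x w, (x, w) ∈ A.graph → R (c • x + d • w) = x := by
  constructor
  · rintro ⟨h1, h2⟩
    refine ⟨fun y ↦ ?_, fun x w hxw ↦ ?_⟩
    · obtain ⟨h, hy⟩ := h1 y
      exact ⟨A ⟨R y, h⟩, A.mem_graph ⟨R y, h⟩, hy⟩
    · obtain ⟨u, rfl, rfl⟩ := A.mem_graph_iff.mp hxw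
      exact h2 u
  · rintro ⟨h1, h2⟩
    refine ⟨fun y ↦ ?_, fun x ↦ h2 x (A x) (A.mem_graph x)⟩
    obtain ⟨w, hw, hy⟩ := h1 y
    obtain ⟨u, hu, rfl⟩ := A.mem_graph_iff.mp hw
    have hu' : (u : X) = R y := hu
    have hd : R y ∈ A.domain := by rw [← hu']; exact u.2
    have : (⟨R y, hd⟩ : A.domain) = u := Subtype.ext hu'.symm
    refine ⟨hd, ?_⟩
    change c • R y + d • A ⟨R y, hd⟩ = y
    rw [this, hy]

theorem IsBoundedInverse.unique {B : X →ₗ.[ℂ] X} {R R' : X →L[ℂ] X} (h : IsBoundedInverse B R)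
    (h' : IsBoundedInverse B R') : R = R' := by
  ext y
  obtain ⟨hd, hy⟩ := h.1 y
  have := h'.2 ⟨R y, hd⟩
  rw [hy] at this
  exact this.symm

theorem IsBoundedInverse.boundedInverse_eq {B : X →ₗ.[ℂ] X} {R : X →L[ℂ] X}
    (h : IsBoundedInverse B R) : boundedInverse B = R := by
  have h' : ∃ R : X →L[ℂ] X, IsBoundedInverse B R := ⟨R, h⟩
  rw [boundedInverse, dif_pos h']
  exact h'.choose_spec.unique h

end BoundedInverse

namespace BoundedC0Semigroup

variable {X : Type*} [NormedAddCommGroup X] [NormedSpace ℂ X] [CompleteSpace X]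
  {T : BoundedC0Semigroup X} {A : X →ₗ.[ℂ] X}

theorem IsEulerOp.isBoundedInverse {h : ℝ≥0} {Q : X →L[ℂ] X} (hQ : T.IsEulerOp h Q)
    (hA : T.IsGenerator (-A)) (hh : 0 < h) :
    IsBoundedInverse ((LinearMap.id : X →ₗ[ℂ] X) +ᵥ (((h : ℝ) : ℂ) • A)) Q := by
  have hh0 : ((h : ℝ) : ℂ) ≠ 0 := by exact_mod_cast hh.ne'
  rw [← one_smul ℂ (LinearMap.id : X →ₗ[ℂ] X), isBoundedInverse_vadd_smul_iff]
  refine ⟨fun y ↦ ⟨_, hQ.mem_graph hA hh y, ?_⟩, fun x w hxw ↦ ?_⟩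
  · rw [smul_smul, mul_inv_cancel₀ hh0, one_smul, one_smul, add_sub_cancel]
  · rw [one_smul, hQ.apply_add hA hh hxw]

theorem eulerError_eq {n : ℕ} (hn : 1 ≤ n) {t : ℝ≥0} (ht : 0 < t) (hA : T.IsGenerator (-A))
    {Q : X →L[ℂ] X} (hQ : T.IsEulerOp (t / n) Q) :
    T.eulerError A n t = Q ^ n - T.toFun (t / n) ^ n := by
  have hn0 : (n : ℝ≥0) ≠ 0 := by exact_mod_cast (by lia : n ≠ 0)
  have hh : 0 < t / n := div_pos ht (pos_iff_ne_zero.mpr hn0)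
  have h1 := (hQ.isBoundedInverse hA hh).boundedInverse_eq
  rw [NNReal.coe_div, NNReal.coe_natCast] at h1
  rw [eulerError, h1, ← toFun_nsmul, nsmul_eq_mul, mul_div_cancel₀ _ hn0]

end BoundedC0Semigroup

namespace BoundedC0Semigroup

variable {X : Type*} [NormedAddCommGroup X] [NormedSpace ℂ X]

/-! ### Injectivity of the generator and imaginary spectrum -/

/-- The semigroup `e^{isr} T(r)`. -/
def rotate (T : BoundedC0Semigroup X) (s : ℝ) : BoundedC0Semigroup X where
  toFun r := Complex.exp ((r : ℝ) * (s * Complex.I)) • T.toFun r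
  map_zero' := by simp [T.map_zero']
  map_add' r r' := by
    ext x
    change (_ : ℂ) • T.toFun (r + r') x = (_ : ℂ) • T.toFun r ((_ : ℂ) • T.toFun r' x)
    rw [map_smul, smul_smul, T.map_add', ← Complex.exp_add]
    push_cast
    rw [add_mul]
    rfl
  continuous' x := by
    have := T.continuous' x
    change Continuous fun r : ℝ≥0 ↦ Complex.exp ((r : ℝ) * (s * Complex.I)) • T.toFun r x
    fun_prop
  bounded' := by
    obtain ⟨M, hM⟩ := T.bounded'
    refine ⟨M, fun r ↦ ?_⟩
    rw [norm_smul, Complex.norm_exp]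
    simpa using hM r

theorem rotate_apply (T : BoundedC0Semigroup X) (s : ℝ) (r : ℝ≥0) (x : X) :
    (T.rotate s).toFun r x = Complex.exp ((r : ℝ) * (s * Complex.I)) • T.toFun r x := rfl

theorem norm_rotate (T : BoundedC0Semigroup X) (s : ℝ) (r : ℝ≥0) :
    ‖(T.rotate s).toFun r‖ = ‖T.toFun r‖ := by
  change ‖Complex.exp ((r : ℝ) * (s * Complex.I)) • T.toFun r‖ = _
  rw [norm_smul, Complex.norm_exp]
  simp

theorem tendsto_coe_nhdsGT_zero : Tendsto ((↑) : ℝ≥0 → ℝ) (𝓝[>] 0) (𝓝[≠] 0) := by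
  refine tendsto_nhdsWithin_iff.mpr ⟨?_, ?_⟩
  · exact (NNReal.continuous_coe.tendsto 0).mono_left nhdsWithin_le_nhds
  · filter_upwards [self_mem_nhdsWithin] with k hk
    exact_mod_cast ne_of_gt hk

theorem tendsto_rotate (T : BoundedC0Semigroup X) (s : ℝ) {x y : X}
    (h : Tendsto (fun k : ℝ≥0 ↦ (k : ℝ)⁻¹ • (T.toFun k x - x)) (𝓝[>] 0) (𝓝 y)) :
    Tendsto (fun k : ℝ≥0 ↦ (k : ℝ)⁻¹ • ((T.rotate s).toFun k x - x)) (𝓝[>] 0)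
      (𝓝 (y + ((s : ℂ) * Complex.I) • x)) := by
  have h1 : HasDerivAt (fun r : ℝ ↦ Complex.exp (r * (s * Complex.I))) (s * Complex.I) 0 := by
    have := ((hasDerivAt_id (0 : ℝ)).ofReal_comp.mul_const (s * Complex.I)).cexp
    simpa using this
  have h2 := (h1.tendsto_slope_zero.comp tendsto_coe_nhdsGT_zero).smul_const x
  have h3 : Continuous fun k : ℝ≥0 ↦ Complex.exp ((k : ℝ) * (s * Complex.I)) := by fun_prop
  have h4 := ((h3.tendsto 0).mono_left nhdsWithin_le_nhds).smul h
  have h5 := h4.add h2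
  simp only [NNReal.coe_zero, Complex.ofReal_zero, zero_mul, Complex.exp_zero, one_smul] at h5
  refine h5.congr fun k ↦ ?_
  simp only [Function.comp_apply, zero_add, rotate_apply, ← Complex.coe_smul, smul_eq_mul]
  module

theorem mem_graph_vadd_iff (B : X →ₗ[ℂ] X) (A : X →ₗ.[ℂ] X) {x y : X} :
    (x, y) ∈ (B +ᵥ A).graph ↔ (x, y - B x) ∈ A.graph := by
  rw [LinearPMap.mem_graph_iff, LinearPMap.mem_graph_iff]
  constructor
  · rintro ⟨u, rfl, hy⟩
    refine ⟨u, rfl, ?_⟩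
    rw [LinearPMap.vadd_apply] at hy
    exact eq_sub_of_add_eq' hy
  · rintro ⟨u, rfl, hy⟩
    refine ⟨u, rfl, ?_⟩
    rw [LinearPMap.vadd_apply]
    exact (add_comm _ _).trans (eq_sub_iff_add_eq.mp hy)

theorem mem_graph_neg_iff (A : X →ₗ.[ℂ] X) {x y : X} :
    (x, y) ∈ (-A).graph ↔ (x, -y) ∈ A.graph := by
  rw [LinearPMap.mem_graph_iff, LinearPMap.mem_graph_iff]
  constructor
  · rintro ⟨u, hu, hy⟩
    exact ⟨u, hu, by simpa [neg_eq_iff_eq_neg] using hy⟩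
  · rintro ⟨u, hu, hy⟩
    exact ⟨u, hu, by simpa [neg_eq_iff_eq_neg] using hy⟩

/-- Moves the point `is` of the spectrum to the origin while keeping the semigroup bounded. The
reverse implication follows by rotating back by `-s`. -/
theorem IsGenerator.rotate {T : BoundedC0Semigroup X} {A : X →ₗ.[ℂ] X} (hA : T.IsGenerator (-A))
    (s : ℝ) : (T.rotate s).IsGenerator
      (-(((-((s : ℂ) * Complex.I)) • LinearMap.id : X →ₗ[ℂ] X) +ᵥ A)) := by
  intro x y
  rw [mem_graph_neg_iff, mem_graph_vadd_iff, hA.mem_graph_iff]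
  constructor
  · intro h
    simpa using T.tendsto_rotate s h
  · intro h
    have := (T.rotate s).tendsto_rotate (-s) h
    simpa [rotate_apply, smul_smul, ← Complex.exp_add, ← sub_eq_add_neg, add_comm] using this

variable [CompleteSpace X] {T : BoundedC0Semigroup X} {A : X →ₗ.[ℂ] X}

/-- Mean ergodic argument: `Q_h = (1 + hA)⁻¹` fixes `x` and is bounded by `M` for all `h`, while
`Q_h A u = h⁻¹ (u - Q_h u) → 0` as `h → ∞`. Approximating `x` by `A u` gives `x = 0`. -/
theorem IsGenerator.eq_zero_of_dense_range (hA : T.IsGenerator (-A)) (hran : Dense (Set.range A))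
    {x : X} (hx : (x, (0 : X)) ∈ A.graph) : x = 0 := by
  obtain ⟨M, hM0, hM⟩ := T.exists_bound
  refine norm_le_zero_iff.mp (le_of_forall_pos_le_add fun ε hε ↦ ?_)
  have hδ : 0 < ε / (2 * (M + 1)) := by positivity
  obtain ⟨_, ⟨u, rfl⟩, hu⟩ := Metric.mem_closure_iff.mp (hran x) _ hδ
  obtain ⟨N, hN⟩ := exists_nat_gt (2 * ((1 + M) * ‖(u : X)‖) / ε)
  let h : ℝ≥0 := N + 1
  have hh : 0 < h := by positivity
  have hhN : (h : ℝ) = N + 1 := rfl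
  have hh0 : ((h : ℝ) : ℂ) ≠ 0 := by exact_mod_cast hh.ne'
  obtain ⟨Q, hQ, hQM⟩ := T.exists_isEulerOp h
  have h1 : Q x = x := by simpa using hQ.apply_add hA hh hx
  have h2 : Q (A u) = ((h : ℝ) : ℂ)⁻¹ • ((u : X) - Q u) := by
    have := hQ.apply_add hA hh (A.mem_graph u)
    rw [map_add, map_smul] at this
    rw [eq_inv_smul_iff₀ hh0]
    exact eq_sub_of_add_eq' this
  have h3 : ‖Q (x - A u)‖ ≤ ε / 2 := by
    refine (Q.le_of_opNorm_le (hQM M hM) _).trans ?_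
    rw [dist_eq_norm, lt_div_iff₀ (by positivity)] at hu
    nlinarith [norm_nonneg (x - A u)]
  have h4 : ‖Q (A u)‖ ≤ ε / 2 := by
    rw [h2, norm_smul, norm_inv, Complex.norm_real, Real.norm_of_nonneg h.coe_nonneg,
      inv_mul_le_iff₀ (by exact_mod_cast hh)]
    have h5 : ‖(u : X) - Q u‖ ≤ (1 + M) * ‖(u : X)‖ := by
      refine (norm_sub_le _ _).trans ?_
      linarith [Q.le_of_opNorm_le (hQM M hM) u]
    rw [div_lt_iff₀ hε] at hN
    rw [hhN]
    nlinarith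
  calc ‖x‖ = ‖Q (x - A u) + Q (A u)‖ := by rw [← map_add, sub_add_cancel, h1]
    _ ≤ ‖Q (x - A u)‖ + ‖Q (A u)‖ := norm_add_le _ _
    _ ≤ 0 + ε := by linarith

/-- For `Q = (1 + tA)⁻¹`, the lower bound applied to `A Q y = t⁻¹ (y - Q y)` gives `ct ‖Q y‖ ≤ ‖y‖ +
‖Q y‖`. The choice `ct = 3` yields `‖Q‖ ≤ 1/2`; then `1 - Q` is invertible and `A⁻¹ = t Q (1 -
Q)⁻¹`. -/
theorem IsGenerator.exists_isBoundedInverse (hA : T.IsGenerator (-A)) {c : ℝ} (hc : 0 < c)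
    (h : ∀ x y, (x, y) ∈ A.graph → c * ‖x‖ ≤ ‖y‖) :
    ∃ R : X →L[ℂ] X, (∀ y, (R y, y) ∈ A.graph) ∧ ∀ x y, (x, y) ∈ A.graph → R y = x := by
  let t : ℝ≥0 := 3 / c.toNNReal
  have hc' : 0 < c.toNNReal := Real.toNNReal_pos.mpr hc
  have ht : 0 < t := by positivity
  have htc : (t : ℝ) = 3 / c := by simp [t, hc.le]
  have ht0 : ((t : ℝ) : ℂ) ≠ 0 := by exact_mod_cast ht.ne'
  obtain ⟨Q, hQ, -⟩ := T.exists_isEulerOp t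
  have hQ1 : ‖Q‖ < 1 := by
    refine lt_of_le_of_lt (Q.opNorm_le_bound (by norm_num : (0 : ℝ) ≤ 1 / 2) fun y ↦ ?_)
      (by norm_num : (1 / 2 : ℝ) < 1)
    have h1 := h _ _ (hQ.mem_graph hA ht y)
    rw [norm_smul, norm_inv, Complex.norm_real, Real.norm_of_nonneg t.coe_nonneg, htc, inv_div,
      div_mul_eq_mul_div, le_div_iff₀ (by norm_num), mul_assoc] at h1
    have h2 := le_of_mul_le_mul_left h1 hc
    linarith [norm_sub_le y (Q y)]
  let V := Units.oneSub Q hQ1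
  have hV (y : X) : (V⁻¹ : (X →L[ℂ] X)ˣ).1 y - Q ((V⁻¹ : (X →L[ℂ] X)ˣ).1 y) = y :=
    congrArg (fun B : X →L[ℂ] X ↦ B y) V.mul_inv
  have hV' (y : X) : (V⁻¹ : (X →L[ℂ] X)ˣ).1 (y - Q y) = y :=
    congrArg (fun B : X →L[ℂ] X ↦ B y) V.inv_mul
  have hcomm (y : X) : Q ((V⁻¹ : (X →L[ℂ] X)ˣ).1 y) = (V⁻¹ : (X →L[ℂ] X)ˣ).1 (Q y) := by
    have : Commute Q V.1 := (Commute.one_right Q).sub_right (Commute.refl Q)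
    exact congrArg (fun B : X →L[ℂ] X ↦ B y) this.units_inv_right.eq
  refine ⟨((t : ℝ) : ℂ) • (Q * (V⁻¹ : (X →L[ℂ] X)ˣ).1), fun y ↦ ?_, fun x y hxy ↦ ?_⟩
  · have h1 := A.graph.smul_mem ((t : ℝ) : ℂ) (hQ.mem_graph hA ht ((V⁻¹ : (X →L[ℂ] X)ˣ).1 y))
    rw [hV, Prod.smul_mk, smul_smul, mul_inv_cancel₀ ht0, one_smul] at h1
    exact h1
  · have h1 := hQ.apply_add hA ht hxy
    rw [map_add, map_smul] at h1
    change ((t : ℝ) : ℂ) • Q ((V⁻¹ : (X →L[ℂ] X)ˣ).1 y) = x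
    rw [hcomm, ← map_smul, eq_sub_of_add_eq' h1, hV']

/-- A point of the spectrum on the imaginary axis is an approximate eigenvalue. -/
theorem IsGenerator.exists_approx_eigenvector (hA : T.IsGenerator (-A)) {s : ℝ}
    (hs : (s : ℂ) * Complex.I ∈ operatorSpectrum A) {c : ℝ} (hc : 0 < c) :
    ∃ x y, (x, y) ∈ A.graph ∧ ‖x‖ = 1 ∧ ‖y - ((s : ℂ) * Complex.I) • x‖ < c := by
  by_contra! hcon
  refine hs ?_
  have hg (x y : X) : (x, y) ∈ (((-((s : ℂ) * Complex.I)) • LinearMap.id : X →ₗ[ℂ] X) +ᵥ A).graph ↔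
      (x, y + ((s : ℂ) * Complex.I) • x) ∈ A.graph := by
    rw [mem_graph_vadd_iff]
    simp
  -- Without approximate eigenvectors, normalization makes `A - is` bounded below by `c`, hence
  -- boundedly invertible.
  obtain ⟨R, hR1, hR2⟩ := (hA.rotate s).exists_isBoundedInverse hc fun x y hxy ↦ by
    rw [hg] at hxy
    rcases eq_or_ne x 0 with rfl | hx
    · simp
    have hx' : 0 < ‖x‖ := norm_pos_iff.mpr hx
    have := hcon _ _ (A.graph.smul_mem ((‖x‖⁻¹ : ℝ) : ℂ) hxy) (by simp [norm_smul, hx'.ne'])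
    rw [smul_add, smul_comm _ ((‖x‖⁻¹ : ℝ) : ℂ) x, add_sub_cancel_right] at this
    rw [norm_smul, Complex.norm_real, norm_inv, norm_norm, le_inv_mul_iff₀ hx'] at this
    linarith
  have hneg : -A = (-1 : ℂ) • A := by
    refine LinearPMap.ext rfl fun u hu hu' ↦ ?_
    simp [LinearPMap.neg_apply, LinearPMap.smul_apply]
  refine ⟨-R, ?_⟩
  rw [hneg, isBoundedInverse_vadd_smul_iff]
  refine ⟨fun y ↦ ?_, fun x w hxw ↦ ?_⟩
  · have h1 := A.graph.neg_mem ((hg _ _).mp (hR1 y))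
    refine ⟨_, h1, ?_⟩
    simp
  · have h1 := hR2 x (w - ((s : ℂ) * Complex.I) • x) ((hg _ _).mpr (by simpa using hxw))
    rw [← h1]
    simp only [neg_apply, ← map_neg]
    congr 1
    rw [h1]
    module

/-- Multiplication by the unimodular factor `e^{irs}` turns this into the estimate for the rotated
semigroup. -/
theorem IsGenerator.norm_sub_exp_smul_le (hA : T.IsGenerator (-A)) {M : ℝ}
    (hM : ∀ t, ‖T.toFun t‖ ≤ M) (s : ℝ) {x y : X} (hxy : (x, y) ∈ A.graph) (r : ℝ≥0) :
    ‖T.toFun r x - Complex.exp (-((r : ℝ) : ℂ) * (s * Complex.I)) • x‖ ≤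
      r * (M * ‖y - ((s : ℂ) * Complex.I) • x‖) := by
  have h1 := (hA.rotate s).norm_semigroup_sub_le (M := M) (fun t ↦ (T.norm_rotate s t).trans_le (hM t))
    (x := x) (y := y - ((s : ℂ) * Complex.I) • x)
    ((mem_graph_vadd_iff _ A).mpr (by simpa using hxy)) r
  refine le_trans (le_of_eq ?_) h1
  have h2 : T.toFun r x - Complex.exp (-((r : ℝ) : ℂ) * (s * Complex.I)) • x =
      Complex.exp (-((r : ℝ) : ℂ) * (s * Complex.I)) • ((T.rotate s).toFun r x - x) := by
    rw [rotate_apply, smul_sub, smul_smul, ← Complex.exp_add]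
    simp
  rw [h2, norm_smul, Complex.norm_exp]
  simp

/-- The pairs with this property form an algebra, and dominated convergence puts every finite
positive measure in it. -/
theorem tendsto_sub_smul_of_mem {x : ℕ → X} (hx : ∀ n, ‖x n‖ = 1) {z : ClosedHalfPlane}
    (h : ∀ r : ℝ≥0, Tendsto (fun n ↦ T.toFun r (x n) - Complex.exp (-((r : ℝ) : ℂ) * z) • x n)
      atTop (𝓝 0))
    {F : (ClosedHalfPlane → ℂ) × (X →L[ℂ] X)} (hF : F ∈ T.calculusAlgebra) :
    Tendsto (fun n ↦ F.2 (x n) - F.1 z • x n) atTop (𝓝 0) := by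
  obtain ⟨M, hM0, hM⟩ := T.exists_bound
  induction hF using Algebra.adjoin_induction with
  | mem F hF =>
    obtain ⟨m, hm, rfl⟩ := hF
    have hlim := tendsto_integral_of_dominated_convergence (μ := m) (fun _ ↦ M + 1)
      (F := fun n (r : ℝ≥0) ↦ T.toFun r (x n) - Complex.exp (-((r : ℝ) : ℂ) * z) • x n)
      (f := fun _ ↦ 0)
      (fun n ↦ (((T.continuous' (x n)).sub
        ((continuous_laplaceKernel z).smul continuous_const))).aestronglyMeasurable)
      (integrable_const _)
      (fun n ↦ Eventually.of_forall fun r ↦ by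
        refine (norm_sub_le _ _).trans (add_le_add ?_ ?_)
        · simpa [hx] using (T.toFun r).le_of_opNorm_le (hM r) (x n)
        · rw [norm_smul, hx, mul_one]
          exact norm_laplaceKernel_le z.2 r)
      (Eventually.of_forall h)
    rw [integral_zero] at hlim
    refine hlim.congr fun n ↦ ?_
    rw [integral_sub (T.integrable_orbit_measure m _)
      ((integrable_laplaceKernel m z.2).smul_const _), integral_smul_const]
    rfl
  | algebraMap c =>
    refine tendsto_const_nhds.congr fun n ↦ ?_
    simp [Algebra.algebraMap_eq_smul_one]
  | add F G _ _ hF hG =>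
    have := hF.add hG
    rw [add_zero] at this
    refine this.congr fun n ↦ ?_
    change _ = F.2 (x n) + G.2 (x n) - (F.1 z + G.1 z) • x n
    module
  | mul F G _ _ hF hG =>
    have h1 : Tendsto (fun n ↦ F.2 (G.2 (x n) - G.1 z • x n)) atTop (𝓝 0) := by
      have := (F.2.continuous.tendsto 0).comp hG
      rwa [map_zero] at this
    have h2 := h1.add (hF.const_smul (G.1 z))
    rw [smul_zero, add_zero] at h2
    refine h2.congr fun n ↦ ?_
    change _ = F.2 (G.2 (x n)) - (F.1 z * G.1 z) • x n
    rw [map_sub, map_smul]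
    module

/-- The spectral inclusion theorem of the Hille-Phillips calculus, on the imaginary axis. -/
theorem IsGenerator.norm_apply_le_opNorm (hA : T.IsGenerator (-A)) {s : ℝ}
    (hs : (s : ℂ) * Complex.I ∈ operatorSpectrum A)
    {F : (ClosedHalfPlane → ℂ) × (X →L[ℂ] X)} (hF : F ∈ T.calculusAlgebra) :
    ‖F.1 ⟨(s : ℂ) * Complex.I, by simp⟩‖ ≤ ‖F.2‖ := by
  obtain ⟨M, hM0, hM⟩ := T.exists_bound
  choose x y hxy hx hy using fun n : ℕ ↦
    hA.exists_approx_eigenvector hs (c := 1 / ((n : ℝ) + 1)) (by positivity)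
  have h0 := tendsto_one_div_add_atTop_nhds_zero_nat (𝕜 := ℝ)
  have h1 := tendsto_sub_smul_of_mem hx (z := ⟨(s : ℂ) * Complex.I, by simp⟩) (fun r ↦ by
    refine squeeze_zero_norm (fun n ↦ (hA.norm_sub_exp_smul_le hM s (hxy n) r).trans
      (mul_le_mul_of_nonneg_left (mul_le_mul_of_nonneg_left (hy n).le hM0) r.2)) ?_
    simpa using (h0.const_mul M).const_mul (r : ℝ)) hF
  refine le_of_forall_pos_le_add fun ε hε ↦ ?_
  obtain ⟨n, hn⟩ := ((tendsto_order.mp h1.norm).2 ε (by simpa using hε)).exists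
  have h2 := norm_sub_norm_le (F.1 ⟨(s : ℂ) * Complex.I, by simp⟩ • x n) (F.2 (x n))
  rw [norm_smul, hx, mul_one, norm_sub_rev] at h2
  have h3 := F.2.le_opNorm (x n)
  rw [hx, mul_one] at h3
  linarith

end BoundedC0Semigroup

/-! ### Stieltjes functions -/

theorem ClosedHalfPlane.mem_slitPlane {z : ℂ} (hz : 0 ≤ z.re) (hz0 : z ≠ 0) :
    z ∈ Complex.slitPlane := by
  rcases hz.lt_or_eq with h | h
  · exact Or.inl h
  · exact Or.inr fun h' ↦ hz0 (Complex.ext h.symm h')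

/-- As `Re z ≥ 0`, the modulus `|z + τ|` dominates both `τ` and `|z|`. -/
theorem norm_stieltjesKernel_le {z : ℂ} (hz : 0 ≤ z.re) (hz0 : z ≠ 0) (τ : ℝ≥0) :
    ‖(z + ((τ : ℝ) : ℂ))⁻¹‖ ≤ (1 + ‖z‖⁻¹) * (1 + (τ : ℝ))⁻¹ := by
  have hz0' : 0 < ‖z‖ := norm_pos_iff.mpr hz0
  have h1 : (τ : ℝ) ≤ ‖z + ((τ : ℝ) : ℂ)‖ := by
    refine le_trans ?_ (Complex.re_le_norm _)
    simpa using hz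
  have h2 : ‖z‖ ≤ ‖z + ((τ : ℝ) : ℂ)‖ := by
    rw [← sq_le_sq₀ (norm_nonneg _) (norm_nonneg _), ← Complex.normSq_eq_norm_sq,
      ← Complex.normSq_eq_norm_sq, Complex.normSq_apply, Complex.normSq_apply]
    have := mul_nonneg hz τ.coe_nonneg
    have := τ.coe_nonneg
    simp
    nlinarith
  have h3 : 0 < ‖z + ((τ : ℝ) : ℂ)‖ := hz0'.trans_le h2
  have h4 : 0 < 1 + (τ : ℝ) := by positivity
  rw [norm_inv, inv_le_iff_one_le_mul₀ h3, mul_right_comm, ← div_eq_mul_inv, le_div_iff₀ h4, one_mul,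
    add_mul, one_mul]
  have : 1 ≤ ‖z‖⁻¹ * ‖z + ((τ : ℝ) : ℂ)‖ := by
    rw [← div_eq_inv_mul, le_div_iff₀ hz0']
    linarith
  linarith

theorem integrable_stieltjesKernel {μ : Measure ℝ≥0}
    (hμ : Integrable (fun τ : ℝ≥0 ↦ (1 + (τ : ℝ))⁻¹) μ) {z : ℂ} (hz : 0 ≤ z.re) (hz0 : z ≠ 0) :
    Integrable (fun τ : ℝ≥0 ↦ (z + ((τ : ℝ) : ℂ))⁻¹) μ :=
  (hμ.const_mul (1 + ‖z‖⁻¹)).mono' (by fun_prop)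
    (Eventually.of_forall fun τ ↦ norm_stieltjesKernel_le hz hz0 τ)

/-- The measure is split at `τ = 1`. For `τ ≤ 1`, `z / (z + τ) = 1 - (1 + z/τ)⁻¹` and `μ` is finite
there; for `τ > 1`, `1 / (z + τ) = τ⁻¹ (1 + z/τ)⁻¹` and `μ(dτ) / τ` is finite. The remaining factors
are `(1 + z)⁻¹` and `z / (1 + z) = 1 - (1 + z)⁻¹`. -/
theorem BoundedC0Semigroup.exists_mem_of_isStieltjes {X : Type*} [NormedAddCommGroup X]
    [NormedSpace ℂ X] (T : BoundedC0Semigroup X) {f : ℂ → ℂ} (hf : IsStieltjes f) :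
    ∃ F ∈ T.calculusAlgebra, ∀ z : ClosedHalfPlane, (z : ℂ) ≠ 0 →
      (1 + (z : ℂ)) * F.1 z = z * f z := by
  obtain ⟨a, μ, -, hμ, hf⟩ := hf
  have hfin : IsFiniteMeasure (μ.restrict (Set.Iic 1)) := by
    refine ⟨?_⟩
    rw [Measure.restrict_apply_univ]
    refine (measure_mono fun τ hτ ↦ ?_).trans_lt (hμ.measure_ge_lt_top (ε := 1 / 2) (by norm_num))
    have : (τ : ℝ) ≤ 1 := hτ
    have := τ.coe_nonneg
    simp only [Set.mem_ofPred_eq]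
    rw [one_div]
    exact inv_anti₀ (by positivity) (by linarith)
  have hfin1 : IsFiniteMeasure (μ.restrict (Set.Ioc 0 1)) :=
    isFiniteMeasure_of_le _ (Measure.restrict_mono_set μ Set.Ioc_subset_Iic_self)
  have hfin2 : IsFiniteMeasure ((μ.restrict (Set.Ioi 1)).withDensity
      fun τ : ℝ≥0 ↦ ENNReal.ofReal (τ : ℝ)⁻¹) := by
    refine isFiniteMeasure_withDensity_ofReal (Integrable.hasFiniteIntegral ?_)
    refine (hμ.integrableOn.const_mul 2).mono' (by fun_prop) ?_
    filter_upwards [ae_restrict_mem measurableSet_Ioi] with τ hτ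
    have h1 : (1 : ℝ) < τ := hτ
    rw [Real.norm_of_nonneg (by positivity), ← div_eq_mul_inv, le_div_iff₀ (by positivity),
      inv_mul_le_iff₀ (by positivity)]
    linarith
  obtain ⟨Q, hQ, hQ1, -⟩ := T.exists_mem_inv_one_add 1
  -- An atom of `μ` at `0` is left out here: `τ / (z + τ)` vanishes there.
  obtain ⟨E, hE, hE1⟩ := T.exists_mem_integral_inv_one_add ((μ.restrict (Set.Ioc 0 1)).map (·⁻¹))
  obtain ⟨G, hG, hG1⟩ := T.exists_mem_integral_inv_one_add (((μ.restrict (Set.Ioi 1)).withDensity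
      fun τ : ℝ≥0 ↦ ENNReal.ofReal (τ : ℝ)⁻¹).map (·⁻¹))
  have hsmul := T.calculusAlgebra.smul_mem (one_mem _)
  refine ⟨(a : ℂ) • (1 - Q) + Q * ((μ.real (Set.Iic 1) : ℂ) • 1 - E) + (1 - Q) * G,
    add_mem (add_mem (T.calculusAlgebra.smul_mem (sub_mem (one_mem _) hQ) _)
      (mul_mem hQ (sub_mem (hsmul _) hE))) (mul_mem (sub_mem (one_mem _) hQ) hG), fun z hz ↦ ?_⟩
  have hne (τ : ℝ≥0) : (z : ℂ) + ((τ : ℝ) : ℂ) ≠ 0 := by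
    intro h0
    have hre := congrArg Complex.re h0
    have him := congrArg Complex.im h0
    simp only [Complex.add_re, Complex.add_im, Complex.ofReal_re, Complex.ofReal_im,
      Complex.zero_re, Complex.zero_im, add_zero] at hre him
    exact hz (Complex.ext (by simp; linarith [z.2, τ.coe_nonneg]) him)
  have hkernel (τ : ℝ≥0) (hτ : 0 < τ) :
      (1 + (((τ⁻¹ : ℝ≥0) : ℝ) : ℂ) * z)⁻¹ = ((τ : ℝ) : ℂ) * (z + ((τ : ℝ) : ℂ))⁻¹ := by
    have : ((τ : ℝ) : ℂ) ≠ 0 := by exact_mod_cast hτ.ne'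
    push_cast
    rw [← div_eq_mul_inv, eq_div_iff (hne τ), inv_mul_eq_iff_eq_mul₀, one_add_mul, mul_right_comm,
      inv_mul_cancel₀ this, one_mul, add_comm]
    intro h0
    apply hne τ
    have := congrArg (((τ : ℝ) : ℂ) * ·) h0
    simp only [mul_add, mul_zero, mul_one] at this
    rwa [mul_inv_cancel_left₀ ‹_›, add_comm] at this
  have hint := integrable_stieltjesKernel hμ z.2 hz
  have hE2 : E.1 z = ∫ τ in Set.Iic 1, ((τ : ℝ) : ℂ) * (z + ((τ : ℝ) : ℂ))⁻¹ ∂μ := by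
    rw [hE1, integral_map (by fun_prop) (by fun_prop),
      setIntegral_congr_fun measurableSet_Ioc fun τ hτ ↦ hkernel τ hτ.1]
    refine (setIntegral_eq_of_subset_of_forall_sdiff_eq_zero measurableSet_Iic
      Set.Ioc_subset_Iic_self fun τ hτ ↦ ?_).symm
    have : τ = 0 := by
      by_contra h
      exact hτ.2 ⟨pos_iff_ne_zero.mpr h, hτ.1⟩
    simp [this]
  have hG2 : G.1 z = ∫ τ in Set.Ioi 1, ((z : ℂ) + ((τ : ℝ) : ℂ))⁻¹ ∂μ := by
    rw [hG1, integral_map (by fun_prop) (by fun_prop),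
      integral_withDensity_eq_integral_toReal_smul (by fun_prop) (by simp)]
    refine setIntegral_congr_fun measurableSet_Ioi fun τ hτ ↦ ?_
    have h1 : (0 : ℝ≥0) < τ := one_pos.trans hτ
    have h2 : ((τ : ℝ) : ℂ) ≠ 0 := by exact_mod_cast h1.ne'
    rw [ENNReal.toReal_ofReal (by positivity), hkernel τ h1, Complex.real_smul, Complex.ofReal_inv,
      inv_mul_cancel_left₀ h2]
  have hsplit : ∫ τ : ℝ≥0, ((z : ℂ) + ((τ : ℝ) : ℂ))⁻¹ ∂μ =
      (∫ τ in Set.Iic 1, ((z : ℂ) + ((τ : ℝ) : ℂ))⁻¹ ∂μ) + G.1 z := by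
    rw [hG2, ← Set.compl_Iic, integral_add_compl measurableSet_Iic hint]
  have hIic : (z : ℂ) * ∫ τ in Set.Iic 1, ((z : ℂ) + ((τ : ℝ) : ℂ))⁻¹ ∂μ =
      (μ.real (Set.Iic 1) : ℂ) - E.1 z := by
    have h1 : IntegrableOn (fun τ : ℝ≥0 ↦ (z : ℂ) * ((z : ℂ) + ((τ : ℝ) : ℂ))⁻¹) (Set.Iic 1) μ :=
      hint.integrableOn.const_mul _
    have h2 : ∀ τ : ℝ≥0, ((τ : ℝ) : ℂ) * (z + ((τ : ℝ) : ℂ))⁻¹ =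
        1 - z * ((z : ℂ) + ((τ : ℝ) : ℂ))⁻¹ := fun τ ↦ by
      rw [eq_sub_iff_add_eq, ← add_mul, add_comm, mul_inv_cancel₀ (hne τ)]
    rw [hE2]
    simp only [h2]
    rw [integral_sub (integrable_const _) h1, integral_const_mul]
    simp
  have hq : (1 + (z : ℂ)) * Q.1 z = 1 := by
    have := one_add_mul_ne_zero 1 z
    simp only [NNReal.coe_one, Complex.ofReal_one, one_mul] at this
    rw [hQ1]
    simp [mul_inv_cancel₀ this]
  rw [hf z (ClosedHalfPlane.mem_slitPlane z.2 hz), hsplit]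
  simp only [Prod.fst_add, Prod.fst_mul, Prod.fst_sub, Prod.fst_one, Prod.smul_fst, Pi.add_apply,
    Pi.mul_apply, Pi.sub_apply, Pi.one_apply, Pi.smul_apply, smul_eq_mul]
  linear_combination (-(a : ℂ) + (μ.real (Set.Iic 1) : ℂ) - E.1 z - G.1 z) * hq - hIic

/-- On the positive axis the kernel is strictly positive, so a single zero forces `a = 0` and `μ =
0`. -/
theorem IsStieltjes.ne_zero_of_pos {f : ℂ → ℂ} (hf : IsStieltjes f) {x : ℝ} (hx : 0 < x)
    (hfx : f x ≠ 0) {y : ℝ} (hy : 0 < y) : f y ≠ 0 := by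
  obtain ⟨a, μ, ha, hμ, hf⟩ := hf
  intro h0
  have hint := integrable_stieltjesKernel hμ (z := y) (by simpa using hy.le) (by simpa using hy.ne')
  have hint' : Integrable (fun τ : ℝ≥0 ↦ (y + (τ : ℝ))⁻¹) μ := by
    refine (hint.re).congr (Eventually.of_forall fun τ ↦ ?_)
    simp only [← Complex.ofReal_add, ← Complex.ofReal_inv]
    exact Complex.ofReal_re _
  have h1 : (((a + ∫ τ : ℝ≥0, (y + (τ : ℝ))⁻¹ ∂μ : ℝ)) : ℂ) = 0 := by
    rw [← h0, hf y (by simpa using hy)]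
    simp only [← Complex.ofReal_add, ← Complex.ofReal_inv, integral_complex_ofReal]
  have hnn (τ : ℝ≥0) : 0 < (y + (τ : ℝ))⁻¹ := by positivity
  have h2 : 0 ≤ ∫ τ : ℝ≥0, (y + (τ : ℝ))⁻¹ ∂μ := integral_nonneg fun τ ↦ (hnn τ).le
  have h3 : a + ∫ τ : ℝ≥0, (y + (τ : ℝ))⁻¹ ∂μ = 0 := by exact_mod_cast h1
  have h4 : ∫ τ : ℝ≥0, (y + (τ : ℝ))⁻¹ ∂μ = 0 := by linarith
  rw [integral_eq_zero_iff_of_nonneg (fun τ ↦ (hnn τ).le) hint'] at h4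
  have h5 : μ = 0 := by
    rw [← ae_eq_bot, ← eventually_false_iff_eq_bot]
    exact h4.mono fun τ hτ ↦ (hnn τ).ne' hτ
  apply hfx
  rw [hf x (by simpa using hx), h5, show a = 0 by linarith]
  simp

/-- Multiplication by `w = 1 ± i`, with the sign of `s`, gives `Re (w / (is + τ)) = (|s| + τ) / (s²
+ τ²) ≥ 1 / (|s| + τ)`, so no cancellation occurs under the integral; `|w| = √2` is the loss. -/
theorem IsStieltjes.norm_abs_le {f : ℂ → ℂ} (hf : IsStieltjes f) {s : ℝ} (hs : s ≠ 0) :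
    ‖f (|s| : ℝ)‖ ≤ √2 * ‖f (s * Complex.I)‖ := by
  obtain ⟨a, μ, ha, hμ, hf⟩ := hf
  have hs' : 0 < |s| := abs_pos.mpr hs
  have hint := integrable_stieltjesKernel hμ (z := (|s| : ℝ)) (by simp)
    (by simpa using hs)
  have hint' : Integrable (fun τ : ℝ≥0 ↦ (|s| + (τ : ℝ))⁻¹) μ := by
    refine (hint.re).congr (Eventually.of_forall fun τ ↦ ?_)
    simp only [← Complex.ofReal_add, ← Complex.ofReal_inv]
    exact Complex.ofReal_re _
  have hintI := integrable_stieltjesKernel hμ (z := s * Complex.I) (by simp) (by simpa using hs)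
  have h1 : f (|s| : ℝ) = ((a + ∫ τ : ℝ≥0, (|s| + (τ : ℝ))⁻¹ ∂μ : ℝ) : ℂ) := by
    rw [hf _ (by simpa using hs)]
    simp only [← Complex.ofReal_add, ← Complex.ofReal_inv, integral_complex_ofReal]
  obtain ⟨σ, hσ, hσ2⟩ : ∃ σ : ℝ, σ * s = |s| ∧ σ ^ 2 = 1 := by
    rcases abs_choice s with h | h
    · exact ⟨1, by simp [h]⟩
    · exact ⟨-1, by simp [h]⟩
  let w : ℂ := 1 + σ * Complex.I
  have hw : ‖w‖ = √2 := by
    rw [Complex.norm_eq_sqrt_sq_add_sq]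
    simp [w, hσ2]
    norm_num
  have h2 : (w * f (s * Complex.I)).re =
      a + ∫ τ : ℝ≥0, (w * (s * Complex.I + ((τ : ℝ) : ℂ))⁻¹).re ∂μ := by
    rw [hf _ (ClosedHalfPlane.mem_slitPlane (by simp) (by simpa using hs)), mul_add,
      ← integral_const_mul, Complex.add_re]
    congr 1
    · simp [w]
    · exact (integral_re (hintI.const_mul w)).symm
  have h3 : ∫ τ : ℝ≥0, (|s| + (τ : ℝ))⁻¹ ∂μ ≤
      ∫ τ : ℝ≥0, (w * (s * Complex.I + ((τ : ℝ) : ℂ))⁻¹).re ∂μ := by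
    refine integral_mono hint' (hintI.const_mul w).re fun τ ↦ ?_
    have e : (w * (s * Complex.I + ((τ : ℝ) : ℂ))⁻¹).re =
        (|s| + τ) / (s ^ 2 + (τ : ℝ) ^ 2) := by
      rw [Complex.mul_re, Complex.inv_re, Complex.inv_im, ← hσ]
      simp [w, Complex.normSq_apply]
      ring
    change _ ≤ (w * (s * Complex.I + ((τ : ℝ) : ℂ))⁻¹).re
    rw [e, le_div_iff₀ (by positivity), inv_mul_le_iff₀ (by positivity), ← sq_abs s]
    have := mul_nonneg hs'.le τ.coe_nonneg
    nlinarith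
  have h4 : 0 ≤ ∫ τ : ℝ≥0, (|s| + (τ : ℝ))⁻¹ ∂μ := integral_nonneg fun τ ↦ by positivity
  calc ‖f (|s| : ℝ)‖ = a + ∫ τ : ℝ≥0, (|s| + (τ : ℝ))⁻¹ ∂μ := by
        rw [h1, Complex.norm_real, Real.norm_of_nonneg (by positivity)]
    _ ≤ (w * f (s * Complex.I)).re := by rw [h2]; linarith
    _ ≤ ‖w * f (s * Complex.I)‖ := Complex.re_le_norm _
    _ = √2 * ‖f (s * Complex.I)‖ := by rw [norm_mul, hw]

namespace BoundedC0Semigroup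

variable {X : Type*} [NormedAddCommGroup X] [NormedSpace ℂ X] {f : ℂ → ℂ}

/-! ### Products of Stieltjes functions and Euler errors in the calculus -/

theorem one_add_ne_zero (z : ClosedHalfPlane) : 1 + (z : ℂ) ≠ 0 := by
  simpa using one_add_mul_ne_zero 1 z

theorem exists_mem_of_isStieltjesProduct (T : BoundedC0Semigroup X) (hf : IsStieltjesProduct f) :
    ∃ F ∈ T.calculusAlgebra, ∀ z : ClosedHalfPlane, (z : ℂ) ≠ 0 →
      (1 + (z : ℂ)) ^ 2 * F.1 z = z ^ 2 * f z := by
  obtain ⟨f₁, f₂, hf₁, hf₂, hf⟩ := hf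
  obtain ⟨F, hF, hF1⟩ := T.exists_mem_of_isStieltjes hf₁
  obtain ⟨G, hG, hG1⟩ := T.exists_mem_of_isStieltjes hf₂
  refine ⟨F * G, mul_mem hF hG, fun z hz ↦ ?_⟩
  rw [hf z (ClosedHalfPlane.mem_slitPlane z.2 hz)]
  calc (1 + (z : ℂ)) ^ 2 * (F.1 z * G.1 z)
      = ((1 + (z : ℂ)) * F.1 z) * ((1 + (z : ℂ)) * G.1 z) := by ring
    _ = _ := by rw [hF1 z hz, hG1 z hz]; ring

/-- Injectivity of the regularizer is what makes the kernel in the definition a graph. -/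
theorem exists_regularizer_graph {T : BoundedC0Semigroup X} (hf : T.Regularizable f) :
    ∃ μ ν : ComplexMeasure ℝ≥0, T.IsRegularizer f μ ν ∧ ∀ x y,
      (x, y) ∈ (T.extendedCalculus f).graph ↔ T.hillePhillips μ y = T.hillePhillips ν x := by
  refine ⟨hf.2.choose.1, hf.2.choose.2, hf.2.choose_spec, fun x y ↦ ?_⟩
  rw [extendedCalculus, dif_pos hf, Submodule.toLinearPMap_graph_eq]
  · exact sub_eq_zero.trans eq_comm
  · rintro ⟨u, v⟩ huv hu
    have hu' : u = 0 := hu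
    subst hu'
    have h1 : T.hillePhillips hf.2.choose.1 v = 0 := by
      simpa [LinearMap.mem_ker] using huv
    exact hf.2.choose_spec.1 (h1.trans (map_zero _).symm)

variable [CompleteSpace X] {T : BoundedC0Semigroup X} {A : X →ₗ.[ℂ] X}

/-- The regularizer is `(z / (1 + z))²`. A vector killed by `1 - (1 + A)⁻¹` lies in `ker A`, which
is trivial. -/
theorem regularizable_of_isStieltjesProduct (hA : T.IsGenerator (-A))
    (hran : Dense (Set.range A)) (hf : IsStieltjesProduct f) : T.Regularizable f := by
  obtain ⟨F, hF, hF1⟩ := T.exists_mem_of_isStieltjesProduct hf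
  obtain ⟨Q, ⟨E, hE, hE1, rfl⟩, -⟩ := T.exists_isEulerOp 1
  have hpos (z : ℂ) (hz : 0 < z.re) : z ≠ 0 := fun h ↦ by simp [h] at hz
  refine ⟨?_, ?_⟩
  · obtain ⟨g, hg, hgF⟩ := T.exists_differentiableOn_of_mem hF
    have h1 : DifferentiableOn ℂ (fun z : ℂ ↦ (1 + z) ^ 2 * g z / z ^ 2) {z | 0 < z.re} :=
      (((differentiableOn_const 1).add differentiableOn_id).pow 2 |>.mul hg).div
        (differentiableOn_id.pow 2) fun z hz ↦ pow_ne_zero 2 (hpos z hz)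
    refine h1.congr fun z hz ↦ ?_
    have hz' : 0 < z.re := hz
    rw [hgF ⟨z, hz'.le⟩, hF1 ⟨z, hz'.le⟩ (hpos z hz'),
      mul_div_cancel_left₀ _ (pow_ne_zero 2 (hpos z hz'))]
  · have hinj : Function.Injective ((1 - E).2) := by
      rw [injective_iff_map_eq_zero]
      intro x hx
      have hx' : x - E.2 x = 0 := hx
      have hEop : T.IsEulerOp 1 E.2 := ⟨E, hE, hE1, rfl⟩
      have h1 := hEop.mem_graph hA one_pos x
      rw [hx', smul_zero, ← sub_eq_zero.mp hx'] at h1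
      exact hA.eq_zero_of_dense_range hran h1
    have hE' := sub_mem (one_mem T.calculusAlgebra) hE
    obtain ⟨μ, hμ, hμT⟩ := T.exists_complexMeasure_of_mem (mul_mem hE' hE')
    obtain ⟨ν, hν, -⟩ := T.exists_complexMeasure_of_mem hF
    refine ⟨⟨μ, ν⟩, ?_, fun z hz ↦ ?_⟩
    · rw [hμT]
      exact hinj.comp hinj
    · have h1 := hμ ⟨z, hz.le⟩
      have h2 := hν ⟨z, hz.le⟩
      have h3 := hF1 ⟨z, hz.le⟩ (hpos z hz)
      have h4 := one_add_ne_zero ⟨z, hz.le⟩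
      simp only at h1 h2 h3 h4
      have h5 : (1 - E).1 ⟨z, hz.le⟩ = z * (1 + z)⁻¹ := by
        change 1 - E.1 ⟨z, hz.le⟩ = _
        rw [hE1]
        simp only [NNReal.coe_one, Complex.ofReal_one, one_mul]
        field_simp
        ring
      simp only
      rw [h1, h2]
      change (1 - E).1 ⟨z, hz.le⟩ * (1 - E).1 ⟨z, hz.le⟩ * f z = _
      rw [h5]
      field_simp
      linear_combination -h3

/-- The Euler error as an element of the calculus, vanishing at the origin to second order. -/
theorem exists_mem_eulerError (hA : T.IsGenerator (-A)) {n : ℕ} (hn : 1 ≤ n) {t : ℝ≥0}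
    (ht : 0 < t) :
    ∃ D ∈ T.calculusAlgebra, ∃ G ∈ T.calculusAlgebra, D.2 = T.eulerError A n t ∧
      (∀ z : ClosedHalfPlane, D.1 z = ((1 + (((t / n : ℝ≥0) : ℝ) : ℂ) * z)⁻¹) ^ n -
        Complex.exp (-(((t / n : ℝ≥0) : ℝ) : ℂ) * z) ^ n) ∧
      ∀ z : ClosedHalfPlane, (z : ℂ) ^ 2 * G.1 z = (1 + (z : ℂ)) ^ 2 * D.1 z := by
  set h : ℝ≥0 := t / n
  obtain ⟨_, ⟨Q, hQ, hQ1, rfl⟩, -⟩ := T.exists_isEulerOp h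
  obtain ⟨W, hW, V, hV, hW1, hV1, -⟩ := T.exists_mem_average h
  obtain ⟨P, hP, hP1, hP2⟩ : ∃ P ∈ T.calculusAlgebra,
      (∀ z, P.1 z = Complex.exp (-((h : ℝ) : ℂ) * z)) ∧ P.2 = T.toFun h :=
    ⟨_, T.dirac_mem h, fun z ↦ rfl, rfl⟩
  have hQh (z : ClosedHalfPlane) : ((h : ℝ) : ℂ) * z * Q.1 z = 1 - Q.1 z := by
    have := one_add_mul_ne_zero h z
    rw [eq_sub_iff_add_eq, ← add_one_mul, hQ1, add_comm, mul_inv_cancel₀ this]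
  -- With `S` the geometric sum, `Δ = (Q - P) S` and `Q - P = hz (W - Q) = h² z² (Q - V)`. Expanding
  -- `(1 + z)² / z² = 1 + 2/z + 1/z²` and using one form of `Q - P` for each term gives the second
  -- witness.
  refine ⟨Q ^ n - P ^ n, sub_mem (pow_mem hQ n) (pow_mem hP n),
    ((Q - P) + (2 * ((h : ℝ) : ℂ)) • (W - Q) + (((h : ℝ) : ℂ) ^ 2) • (Q - V)) *
      ∑ i ∈ Finset.range n, Q ^ i * P ^ (n - 1 - i),
    mul_mem (add_mem (add_mem (sub_mem hQ hP) (T.calculusAlgebra.smul_mem (sub_mem hW hQ) _))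
      (T.calculusAlgebra.smul_mem (sub_mem hQ hV) _))
      (sum_mem fun i _ ↦ mul_mem (pow_mem hQ _) (pow_mem hP _)), ?_, fun z ↦ ?_, fun z ↦ ?_⟩
  · rw [eulerError_eq hn ht hA ⟨Q, hQ, hQ1, rfl⟩, ← hP2]
    rfl
  · change Q.1 z ^ n - P.1 z ^ n = _
    rw [hQ1, hP1]
  · change (z : ℂ) ^ 2 * (((Q.1 z - P.1 z) + (2 * ((h : ℝ) : ℂ)) * (W.1 z - Q.1 z) +
      ((h : ℝ) : ℂ) ^ 2 * (Q.1 z - V.1 z)) * (∑ i ∈ Finset.range n, Q ^ i * P ^ (n - 1 - i)).1 z) =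
      (1 + (z : ℂ)) ^ 2 * (Q.1 z ^ n - P.1 z ^ n)
    have h1 := hW1 z
    have h2 := hV1 z
    have h3 := hQh z
    rw [← hP1] at h1
    rw [← geom_sum₂_mul]
    have h4 : (∑ i ∈ Finset.range n, Q ^ i * P ^ (n - 1 - i)).1 z =
        ∑ i ∈ Finset.range n, Q.1 z ^ i * P.1 z ^ (n - 1 - i) := by
      simp [Prod.fst_sum]
    rw [h4]
    have h5 : Q.1 z - P.1 z = ((h : ℝ) : ℂ) * z * (W.1 z - Q.1 z) := by linear_combination h3 - h1
    have h6 : W.1 z - Q.1 z = ((h : ℝ) : ℂ) * z * (Q.1 z - V.1 z) := by linear_combination h2 - h3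
    linear_combination (-2 * z - 1) *
      (∑ i ∈ Finset.range n, Q.1 z ^ i * P.1 z ^ (n - 1 - i)) * h5 -
      ((h : ℝ) : ℂ) * z * (∑ i ∈ Finset.range n, Q.1 z ^ i * P.1 z ^ (n - 1 - i)) * h6

/-- If `K = f D` in the calculus, then `f(A) D(A)` is everywhere defined and equal to `K(A)`. -/
theorem compBounded_extendedCalculus_eq (hf : T.Regularizable f)
    {D K : (ClosedHalfPlane → ℂ) × (X →L[ℂ] X)} (hD : D ∈ T.calculusAlgebra)
    (hK : K ∈ T.calculusAlgebra)
    (hKD : ∀ z : ClosedHalfPlane, 0 < z.1.re → K.1 z = f z * D.1 z) :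
    compBounded (T.extendedCalculus f) D.2 = (K.2 : X →ₗ[ℂ] X).toPMap ⊤ := by
  obtain ⟨μ, ν, ⟨-, hμν⟩, hgraph⟩ := T.exists_regularizer_graph hf
  have h1 (x : X) : (D.2 x, K.2 x) ∈ (T.extendedCalculus f).graph := by
    rw [hgraph]
    -- Both `e(A) K(A)` and `(ef)(A) D(A)` come from the function `e f D`.
    refine congrArg (fun B : X →L[ℂ] X ↦ B x) (T.snd_eq_of_fst_eq
      (mul_mem (T.complexMeasure_mem μ) hK) (mul_mem (T.complexMeasure_mem ν) hD) fun z hz ↦ ?_)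
    change laplaceTransform μ z * K.1 z = laplaceTransform ν z * D.1 z
    rw [hKD z hz, ← hμν z hz, mul_assoc]
  have hdom (x : X) : D.2 x ∈ (T.extendedCalculus f).domain :=
    LinearPMap.mem_domain_of_mem_graph (h1 x)
  refine LinearPMap.ext (eq_top_iff.mpr fun x _ ↦ hdom x) fun x hx _ ↦ ?_
  exact (T.extendedCalculus f).mem_graph_snd_inj
    ((T.extendedCalculus f).mem_graph ⟨D.2 x, hdom x⟩) (h1 x) rfl

/-- `K` is the product of `z² f / (1 + z)²` and `(1 + z)² Δ / z²`: the double zero of `Δ` absorbs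
the singularity of `f` at `0`. -/
theorem exists_mem_mul_eulerError (hA : T.IsGenerator (-A)) (hf : IsStieltjesProduct f) {n : ℕ}
    (hn : 1 ≤ n) {t : ℝ≥0} (ht : 0 < t) :
    ∃ D ∈ T.calculusAlgebra, ∃ K ∈ T.calculusAlgebra, D.2 = T.eulerError A n t ∧
      (∀ z : ClosedHalfPlane, D.1 z = ((1 + (((t / n : ℝ≥0) : ℝ) : ℂ) * z)⁻¹) ^ n -
        Complex.exp (-(((t / n : ℝ≥0) : ℝ) : ℂ) * z) ^ n) ∧
      ∀ z : ClosedHalfPlane, (z : ℂ) ≠ 0 → K.1 z = f z * D.1 z := by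
  obtain ⟨D, hD, G, hG, hD2, hD1, hG1⟩ := exists_mem_eulerError hA hn ht
  obtain ⟨F, hF, hF1⟩ := T.exists_mem_of_isStieltjesProduct hf
  refine ⟨D, hD, F * G, mul_mem hF hG, hD2, hD1, fun z hz ↦ ?_⟩
  have h0 := mul_ne_zero (pow_ne_zero 2 (one_add_ne_zero z)) (pow_ne_zero 2 hz)
  refine mul_left_cancel₀ h0 ?_
  change _ * (F.1 z * G.1 z) = _
  linear_combination (z : ℂ) ^ 2 * G.1 z * hF1 z hz + (z : ℂ) ^ 2 * f z * hG1 z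

end BoundedC0Semigroup

/-! ### Pointwise lower bounds on the imaginary axis -/

theorem IsStieltjesProduct.norm_abs_le {f : ℂ → ℂ} (hf : IsStieltjesProduct f) {s : ℝ}
    (hs : s ≠ 0) : ‖f (|s| : ℝ)‖ ≤ 2 * ‖f (s * Complex.I)‖ := by
  obtain ⟨f₁, f₂, hf₁, hf₂, hf⟩ := hf
  rw [hf _ (by simpa using hs),
    hf _ (ClosedHalfPlane.mem_slitPlane (by simp) (by simpa using hs)), norm_mul, norm_mul]
  calc ‖f₁ (|s| : ℝ)‖ * ‖f₂ (|s| : ℝ)‖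
      ≤ (√2 * ‖f₁ (s * Complex.I)‖) * (√2 * ‖f₂ (s * Complex.I)‖) :=
        mul_le_mul (hf₁.norm_abs_le hs) (hf₂.norm_abs_le hs) (norm_nonneg _) (by positivity)
    _ = (√2 * √2) * (‖f₁ (s * Complex.I)‖ * ‖f₂ (s * Complex.I)‖) := by ring
    _ = _ := by rw [Real.mul_self_sqrt (by norm_num)]

theorem IsStieltjesProduct.ne_zero_of_pos {f : ℂ → ℂ} (hf : IsStieltjesProduct f) {x : ℝ}
    (hx : 0 < x) (hfx : f x ≠ 0) {y : ℝ} (hy : 0 < y) : f y ≠ 0 := by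
  obtain ⟨f₁, f₂, hf₁, hf₂, hf⟩ := hf
  rw [hf _ (by simpa using hx)] at hfx
  rw [hf _ (by simpa using hy)]
  exact mul_ne_zero (hf₁.ne_zero_of_pos hx (left_ne_zero_of_mul hfx) hy)
    (hf₂.ne_zero_of_pos hx (right_ne_zero_of_mul hfx) hy)

/-- Here `z = ±i`, so the exponential has modulus `1` while `|1 + z|⁻¹ = 1/√2 ≤ 3/4`. -/
theorem le_norm_euler_sub_exp {z : ℂ} (hre : z.re = 0) (him : z.im ^ 2 = 1) :
    1 / 4 ≤ ‖(1 + z)⁻¹ - Complex.exp (-z)‖ := by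
  have h1 : ‖Complex.exp (-z)‖ = 1 := by simp [Complex.norm_exp, hre]
  have h2 : ‖1 + z‖ = √2 := by
    rw [Complex.norm_eq_sqrt_sq_add_sq]
    simp [hre, him]
    norm_num
  have h3 : (4 / 3 : ℝ) ≤ √2 := Real.le_sqrt_of_sq_le (by norm_num)
  have h4 : ‖(1 + z)⁻¹‖ ≤ 3 / 4 := by
    rw [norm_inv, h2]
    exact (inv_anti₀ (by norm_num) h3).trans (by norm_num)
  have h5 := norm_sub_norm_le (Complex.exp (-z)) (1 + z)⁻¹
  rw [norm_sub_rev] at h5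
  linarith

end

/-! ### Boundedness, and the lower bound along `n = 1` -/

theorem theorem6p5 {X : Type*} [NormedAddCommGroup X] [NormedSpace ℂ X] [CompleteSpace X]
    (T : BoundedC0Semigroup X) (A : X →ₗ.[ℂ] X) (hA : T.IsGenerator (-A))
    (hran : Dense (Set.range A))
    (hspec : ∀ R : ℝ, ∃ s : ℝ, R < |s| ∧ (s : ℂ) * Complex.I ∈ operatorSpectrum A)
    (f : ℂ → ℂ) (hf : IsStieltjesProduct f) (hf0 : ∃ x : ℝ, 0 < x ∧ f x ≠ 0) :
    T.Regularizable f ∧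
    ∃ S : ℕ → ℝ≥0 → X →L[ℂ] X,
      (∀ n : ℕ, ∀ t : ℝ≥0, 1 ≤ n → 0 < t →
        compBounded (T.extendedCalculus f) (T.eulerError A n t) =
          (S n t : X →ₗ[ℂ] X).toPMap ⊤) ∧
      0 < limsup (fun p : ℕ × ℝ≥0 ↦
        ‖S p.1 p.2‖ₑ / ‖f ((√(p.1 : ℝ) / (p.2 : ℝ) : ℝ) : ℂ)‖ₑ) sqrtDivAtTop := by
  have hreg := BoundedC0Semigroup.regularizable_of_isStieltjesProduct hA hran hf
  choose D hD K hK hD2 hD1 hKD using fun p : {p : ℕ × ℝ≥0 // 1 ≤ p.1 ∧ 0 < p.2} ↦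
    BoundedC0Semigroup.exists_mem_mul_eulerError hA hf p.2.1 p.2.2
  classical
  -- The default `0` is harmless: `sqrtDivAtTop` lives on `n ≥ 1`, `t > 0`.
  refine ⟨hreg, fun n t ↦ if h : 1 ≤ n ∧ 0 < t then (K ⟨(n, t), h⟩).2 else 0,
    fun n t hn ht ↦ ?_, ?_⟩
  · beta_reduce
    rw [dif_pos ⟨hn, ht⟩, ← hD2 ⟨(n, t), hn, ht⟩]
    refine BoundedC0Semigroup.compBounded_extendedCalculus_eq hreg (hD _) (hK _) fun z hz ↦
      hKD _ z fun h ↦ ?_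
    simp [h] at hz
  -- The constant is `1/8 = 1/2 · 1/4`: the loss from `f(|s|)` to `f(is)` times the lower bound for
  -- the Euler error at `±i`.
  have hlower (s : ℝ) (hs : s ≠ 0) (hsσ : (s : ℂ) * Complex.I ∈ operatorSpectrum A)
      (h : 1 ≤ 1 ∧ 0 < Real.toNNReal |s|⁻¹) :
      1 / 8 * ‖f (|s| : ℝ)‖ ≤ ‖(K ⟨(1, Real.toNNReal |s|⁻¹), h⟩).2‖ := by
    refine le_trans ?_ (hA.norm_apply_le_opNorm hsσ (hK _))
    rw [hKD _ _ (by simpa using hs), hD1, norm_mul]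
    have h1 := hf.norm_abs_le hs
    have h2 := le_norm_euler_sub_exp (z := ((|s|⁻¹ : ℝ) : ℂ) * (s * Complex.I)) (by simp)
      (by
        rw [Complex.im_ofReal_mul, mul_pow, inv_pow, sq_abs]
        simp [hs])
    have h3 : ((Real.toNNReal |s|⁻¹ / (1 : ℕ) : ℝ≥0) : ℝ) = |s|⁻¹ := by
      simp
    rw [h3, pow_one, pow_one, neg_mul]
    nlinarith [norm_nonneg (f (s * Complex.I))]
  choose s hs hsσ using fun k : ℕ ↦ hspec k
  have hs0 (k : ℕ) : 0 < |s k| := (Nat.cast_nonneg k).trans_lt (hs k)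
  have hsqrt (k : ℕ) : √((1 : ℕ) : ℝ) / (Real.toNNReal |s k|⁻¹ : ℝ) = |s k| := by
    rw [Real.coe_toNNReal _ (inv_nonneg.mpr (hs0 k).le)]
    simp
  have hpos (k : ℕ) : 1 ≤ 1 ∧ 0 < Real.toNNReal |s k|⁻¹ :=
    ⟨le_rfl, Real.toNNReal_pos.mpr (inv_pos.mpr (hs0 k))⟩
  have htend : Tendsto (fun k ↦ ((1 : ℕ), Real.toNNReal |s k|⁻¹)) atTop sqrtDivAtTop := by
    refine tendsto_inf.mpr ⟨tendsto_comap_iff.mpr ?_,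
      tendsto_principal.mpr (Eventually.of_forall hpos)⟩
    refine tendsto_atTop_mono (fun k ↦ ?_) tendsto_natCast_atTop_atTop
    simp only [Function.comp_apply]
    rw [hsqrt]
    exact (hs k).le
  have hc : (0 : ℝ≥0∞) < ENNReal.ofReal (1 / 8) := by simp
  -- A lower bound along one sequence converging in the filter bounds the limsup from below.
  refine hc.trans_le (le_limsup_of_frequently_le (htend.frequently (Eventually.frequently
    (Eventually.of_forall fun k ↦ ?_))))
  obtain ⟨x, hx, hfx⟩ := hf0
  simp only
  rw [hsqrt, dif_pos (hpos k), ENNReal.le_div_iff_mul_le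
    (Or.inl (by simpa using hf.ne_zero_of_pos hx hfx (hs0 k))) (Or.inl (by simp)),
    ← ofReal_norm, ← ofReal_norm, ← ENNReal.ofReal_mul (by norm_num)]
  exact ENNReal.ofReal_le_ofReal (hlower (s k) (abs_pos.mp (hs0 k)) (hsσ k) (hpos k))
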